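/- A family $\mathcal{A}$ of infinite subsets of $\omega$ is almost disjoint if any two distinct members of $\mathcal{A}$ have finite intersection; a MAD family is an infinite almost disjoint family that is maximal under inclusion among almost disjoint families. Let $\mathcal{I}(\mathcal{A})$ be the ideal of all $X\subseteq\omega$ such that $X\setminus\bigcup F$ is finite for some finite $F\subseteq\mathcal{A}$, and let $\mathcal{I}(\mathcal{A})^{+}=\mathcal{P}(\omega)\setminus\mathcal{I}(\mathcal{A})$. The family $\mathcal{A}$ is $+$-Ramsey if for every nonempty tree $T\subseteq\omega^{<\omega}$ such that $\{n\in\omega : s^{\frown}\langle n\rangle\in T\}\in\mathcal{I}(\mathcal{A})^{+}$ for every $s\in T$, there is an infinite branch $f\in[T]$ with $\operatorname{im}(f)\in\mathcal{I}(\mathcal{A})^{+}$. It is completely separable if every $X\in\mathcal{I}(\mathcal{A})^{+}$ contains some $A\in\mathcal{A}$. Let $\mathfrak{a}$ be the least size of a MAD family and $\mathfrak{s}$ the least size of a splitting family, that is, of a family $\mathcal{S}$ of infinite subsets of $\omega$ such that for every infinite $X\subseteq\omega$ there is $S\in\mathcal{S}$ with $X\cap S$ and $X\setminus S$ both infinite.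 **Theorem.** (In ZFC.) There is a $+$-Ramsey MAD family. Moreover, if $\mathfrak{s}\leq\mathfrak{a}$, then there is a $+$-Ramsey MAD family that is completely separable. -/

import Mathlib

/-- An almost disjoint family of infinite subsets of `ω`. -/
def IsAD (𝒜 : Set (Set ℕ)) : Prop :=
  (∀ A ∈ 𝒜, A.Infinite) ∧ 𝒜.Pairwise fun A B => (A ∩ B).Finite

/-- A MAD family: an infinite almost disjoint family that is maximal with respect to inclusion
among the almost disjoint families. (Finite maximal families such as `{ω}` are excluded, as
always in the theory of MAD families.) -/
def IsMAD (𝒜 : Set (Set ℕ)) : Prop :=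
  𝒜.Infinite ∧ Maximal IsAD 𝒜

/-- The ideal on `ω` generated by `𝒜` (and the finite sets): all sets that are almost covered by
a finite union of members of `𝒜`. -/
def genIdeal (𝒜 : Set (Set ℕ)) : Set (Set ℕ) :=
  {X | ∃ F : Set (Set ℕ), F ⊆ 𝒜 ∧ F.Finite ∧ (X \ ⋃₀ F).Finite}

/-- The sets that are positive with respect to the ideal generated by `𝒜`. -/
def positiveSets (𝒜 : Set (Set ℕ)) : Set (Set ℕ) :=
  (genIdeal 𝒜)ᶜ

/-- The set of immediate successors of the node `s` in the tree `T`. -/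
def treeSucc (T : Descriptive.tree ℕ) (s : List ℕ) : Set ℕ :=
  {n | s ++ [n] ∈ T}

/-- The initial segment `⟨f 0, …, f (n - 1)⟩` of `f`. -/
def initSeg (f : ℕ → ℕ) (n : ℕ) : List ℕ :=
  (List.range n).map f

/-- The infinite branches of the tree `T`. -/
def treeBranches (T : Descriptive.tree ℕ) : Set (ℕ → ℕ) :=
  {f | ∀ n, initSeg f n ∈ T}

/-- A (nonempty) tree all of whose nodes have a successor set in `𝒳`. -/
def IsBranchingTree (𝒳 : Set (Set ℕ)) (T : Descriptive.tree ℕ) : Prop :=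
  [] ∈ T ∧ ∀ s ∈ T, treeSucc T s ∈ 𝒳

/-- `𝒜` is `+`-Ramsey. -/
def IsPlusRamsey (𝒜 : Set (Set ℕ)) : Prop :=
  ∀ T : Descriptive.tree ℕ, IsBranchingTree (positiveSets 𝒜) T →
    ∃ f ∈ treeBranches T, Set.range f ∈ positiveSets 𝒜

/-- Every positive set contains a member of `𝒜`. -/
def IsCompletelySeparable (𝒜 : Set (Set ℕ)) : Prop :=
  ∀ X ∈ positiveSets 𝒜, ∃ A ∈ 𝒜, A ⊆ X

/-- `S` splits `X`. -/
def Splits (S X : Set ℕ) : Prop :=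
  (X ∩ S).Infinite ∧ (X \ S).Infinite

/-- A splitting family of infinite subsets of `ω`. -/
def IsSplittingFamily (𝒮 : Set (Set ℕ)) : Prop :=
  (∀ S ∈ 𝒮, S.Infinite) ∧ ∀ X : Set ℕ, X.Infinite → ∃ S ∈ 𝒮, Splits S X

/-- The almost disjointness number `𝔞`, the least size of a MAD family. -/
noncomputable def almostDisjointnessNumber : Cardinal.{0} :=
  sInf {κ | ∃ 𝒜 : Set (Set ℕ), IsMAD 𝒜 ∧ Cardinal.mk 𝒜 = κ}

/-- The splitting number `𝔰`, the least size of a splitting family. -/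
noncomputable def splittingNumber : Cardinal.{0} :=
  sInf {κ | ∃ 𝒮 : Set (Set ℕ), IsSplittingFamily 𝒮 ∧ Cardinal.mk 𝒮 = κ}

open Set Filter Cardinal

/-! The cases `𝔞 < 𝔰` and `𝔰 ≤ 𝔞` are treated separately. If `𝔞 < 𝔰`, any MAD family of size `𝔞`
works (`IsMAD.isPlusRamsey_of_card_lt`). Distinct members `c s` meeting the successor sets are
attached to the nodes `s`, and the branch moves inside `c s`. Since `𝔰 ≤ 𝔡`, the moves can escape
any finitely many members infinitely often (`exists_moves`), so no finite subfamily almost covers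
the branch.

If `𝔰 ≤ 𝔞`, the family is built in `𝔠` stages from a splitting family `e` of length `𝔰`. Each stage
produces a set `Z` with a tag, a function on an initial segment of the index set that tells on which
side of each `e β` the set `Z` almost lies. Sets with incompatible tags are automatically almost
disjoint. A positive set is split repeatedly along a binary tree; one of its `𝔠` branches has a tag
extended by no earlier one. Only fewer than `𝔰 ≤ 𝔞` members then remain to be avoided, so a suitable
`Z` exists inside the given set (`TaggedFamily.exists_fresh_subset`). All of countably many disjoint
pieces of `Z` join the family, which makes every superset of `Z` positive for good.

For a tree, a branch with positive range is needed first (`TaggedFamily.exists_positive_branch`).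
The splitting argument is repeated with sets of nodes in place of positive sets and a well-founded
notion of nullness in place of the ideal; `exists_moves` then steers the branch past the members of
the family. -/

/-- The set `S` or its complement, according to the Boolean `i`. -/
def side (S : Set ℕ) (i : Bool) : Set ℕ := if i then S else Sᶜ

lemma mem_side_not {S : Set ℕ} {i : Bool} {n : ℕ} : n ∈ side S (!i) ↔ n ∉ side S i := by
  cases i <;> simp [side]

lemma compl_side (S : Set ℕ) (i : Bool) : (side S i)ᶜ = side S (!i) := by
  ext n; exact mem_side_not.symm

/-! ### The ideal generated by an almost disjoint family, and its positive sets. -/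

section Ideal

variable {𝒜 ℬ : Set (Set ℕ)} {X Y : Set ℕ}

lemma genIdeal_subset (h : 𝒜 ⊆ ℬ) : genIdeal 𝒜 ⊆ genIdeal ℬ := by
  rintro X ⟨F, hF, hfin, hX⟩
  exact ⟨F, hF.trans h, hfin, hX⟩

lemma positiveSets_subset (h : 𝒜 ⊆ ℬ) : positiveSets ℬ ⊆ positiveSets 𝒜 :=
  compl_subset_compl.2 (genIdeal_subset h)

lemma mem_genIdeal_of_subset (hX : X ∈ genIdeal 𝒜) (h : Y ⊆ X) : Y ∈ genIdeal 𝒜 := by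
  obtain ⟨F, hF, hfin, hX⟩ := hX
  exact ⟨F, hF, hfin, hX.subset (sdiff_subset_sdiff_left h)⟩

lemma positive_of_subset (hY : Y ∈ positiveSets 𝒜) (h : Y ⊆ X) : X ∈ positiveSets 𝒜 :=
  fun hX => hY (mem_genIdeal_of_subset hX h)

lemma finite_mem_genIdeal (hX : X.Finite) : X ∈ genIdeal 𝒜 :=
  ⟨∅, empty_subset _, finite_empty, hX.subset sdiff_subset⟩

lemma union_mem_genIdeal (hX : X ∈ genIdeal 𝒜) (hY : Y ∈ genIdeal 𝒜) :
    X ∪ Y ∈ genIdeal 𝒜 := by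
  obtain ⟨F, hF, hF', hX⟩ := hX
  obtain ⟨G, hG, hG', hY⟩ := hY
  refine ⟨F ∪ G, union_subset hF hG, hF'.union hG', (hX.union hY).subset ?_⟩
  rintro n ⟨h | h, hn⟩
  · exact Or.inl ⟨h, fun h' => hn (sUnion_subset_sUnion subset_union_left h')⟩
  · exact Or.inr ⟨h, fun h' => hn (sUnion_subset_sUnion subset_union_right h')⟩

lemma biUnion_mem_genIdeal {κ : Type*} {s : Set κ} (hs : s.Finite) {f : κ → Set ℕ}
    (hf : ∀ i ∈ s, f i ∈ genIdeal 𝒜) : (⋃ i ∈ s, f i) ∈ genIdeal 𝒜 := by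
  induction s, hs using Set.Finite.induction_on with
  | empty => simpa using finite_mem_genIdeal finite_empty
  | insert _ _ ih =>
    rw [biUnion_insert]
    exact union_mem_genIdeal (hf _ (mem_insert _ _)) (ih fun i hi => hf i (mem_insert_of_mem _ hi))

lemma positive_diff (hX : X ∈ positiveSets 𝒜) (hY : Y ∈ genIdeal 𝒜) :
    X \ Y ∈ positiveSets 𝒜 := fun h =>
  hX (mem_genIdeal_of_subset (union_mem_genIdeal h hY) (by simp))

lemma infinite_of_positive (hX : X ∈ positiveSets 𝒜) : X.Infinite :=
  fun h => hX (finite_mem_genIdeal h)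

/-- A set that is almost disjoint from the members of `𝒜` is almost disjoint from the sets in the
ideal generated by `𝒜`. -/
lemma finite_inter_of_mem_genIdeal (hX : X ∈ genIdeal 𝒜) (hY : ∀ A ∈ 𝒜, (Y ∩ A).Finite) :
    (Y ∩ X).Finite := by
  obtain ⟨F, hF, hfin, hX⟩ := hX
  refine (hX.union (hfin.biUnion fun A hA => hY A (hF hA))).subset ?_
  rintro n ⟨hnY, hnX⟩
  by_cases h : n ∈ ⋃₀ F
  · obtain ⟨A, hA, hn⟩ := h
    exact Or.inr (mem_biUnion hA ⟨hnY, hn⟩)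
  · exact Or.inl ⟨hnX, h⟩

lemma positive_of_almostDisjoint (hX : X.Infinite) (h : ∀ A ∈ 𝒜, (X ∩ A).Finite) :
    X ∈ positiveSets 𝒜 := fun hI => hX (by simpa using finite_inter_of_mem_genIdeal hI h)

lemma positive_of_infinite_hits (had : IsAD 𝒜)
    (h : {A ∈ 𝒜 | (X ∩ A).Infinite}.Infinite) : X ∈ positiveSets 𝒜 := by
  rintro ⟨F, hF, hfin, hX⟩
  obtain ⟨A, ⟨hA, hXA⟩, hAF⟩ := (h.sdiff hfin).nonempty
  refine hXA ((hX.union (hfin.biUnion (t := fun B => A ∩ B) fun B hB => ?_)).subset ?_)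
  · exact had.2 hA (hF hB) fun h => hAF (h ▸ hB)
  · rintro n ⟨hnX, hnA⟩
    by_cases h : n ∈ ⋃₀ F
    · obtain ⟨B, hB, hn⟩ := h
      exact Or.inr (mem_biUnion hB ⟨hnA, hn⟩)
    · exact Or.inl ⟨hnX, h⟩

/-- A positive set either contains an infinite set that is almost disjoint from the family, or it
has infinite intersection with infinitely many members. -/
lemma exists_almostDisjoint_or_infinite_hits (hX : X ∈ positiveSets 𝒜) :
    (∃ Z ⊆ X, Z.Infinite ∧ ∀ A ∈ 𝒜, (Z ∩ A).Finite) ∨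
      {A ∈ 𝒜 | (X ∩ A).Infinite}.Infinite := by
  by_cases h : {A ∈ 𝒜 | (X ∩ A).Infinite}.Infinite
  · exact Or.inr h
  · rw [not_infinite] at h
    refine Or.inl ⟨X \ ⋃₀ {A ∈ 𝒜 | (X ∩ A).Infinite}, sdiff_subset,
      fun hf => hX ⟨_, sep_subset _ _, h, hf⟩, fun A hA => ?_⟩
    by_cases hXA : (X ∩ A).Infinite
    · refine Set.finite_empty.subset ?_
      rintro n ⟨⟨-, hn⟩, hnA⟩
      exact hn ⟨A, ⟨hA, hXA⟩, hnA⟩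
    · exact (not_infinite.1 hXA).subset (inter_subset_inter_left _ sdiff_subset)

/-- There is a sequence of infinite subsets of a positive set such that every set with infinite
intersection with infinitely many of them has a positive trace. -/
lemma exists_positivity_test (had : IsAD 𝒜) (hX : X ∈ positiveSets 𝒜) :
    ∃ C : ℕ → Set ℕ, (∀ n, (C n).Infinite) ∧
      ∀ D : Set ℕ, (∃ᶠ n in atTop, (C n ∩ D).Infinite) → X ∩ D ∈ positiveSets 𝒜 := by
  rcases exists_almostDisjoint_or_infinite_hits hX with ⟨Z, hZX, hZ, hZA⟩ | h
  · refine ⟨fun _ => Z, fun _ => hZ, fun D hD => ?_⟩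
    obtain ⟨n, hD'⟩ := hD.exists
    exact positive_of_subset (positive_of_almostDisjoint hD' fun A hA =>
      (hZA A hA).subset (inter_subset_inter_left _ inter_subset_left))
      (inter_subset_inter_left _ hZX)
  · have e := h.natEmbedding
    refine ⟨fun n => X ∩ (e n : Set ℕ), fun n => (e n).2.2, fun D hD => ?_⟩
    refine positive_of_infinite_hits had ?_
    have hinf := Nat.frequently_atTop_iff_infinite.1 hD
    refine (hinf.image (f := fun n => (e n : Set ℕ))
      fun a _ b _ hab => e.injective (Subtype.ext hab)).mono ?_
    rintro _ ⟨n, hn, rfl⟩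
    refine ⟨(e n).2.1, Set.Infinite.mono ?_ hn⟩
    rintro m ⟨⟨h1, h2⟩, h3⟩
    exact ⟨⟨h1, h3⟩, h2⟩

/-- Every infinite set contains arbitrarily large elements. -/
lemma Set.Infinite.exists_ge_mem {Z : Set ℕ} (hZ : Z.Infinite) (n : ℕ) : ∃ a ∈ Z, n ≤ a := by
  obtain ⟨a, ha, h⟩ := hZ.exists_gt n
  exact ⟨a, ha, h.le⟩

/-- A decreasing sequence of positive sets has a positive pseudo-intersection. -/
lemma exists_positive_pseudoIntersection (had : IsAD 𝒜) {X : ℕ → Set ℕ} (hanti : Antitone X)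
    (hX : ∀ n, X n ∈ positiveSets 𝒜) :
    ∃ Y ⊆ X 0, Y ∈ positiveSets 𝒜 ∧ ∀ n, (Y \ X n).Finite := by
  -- If infinitely many members meet every `X n` in an infinite set, a diagonal set meets infinitely
  -- many of them infinitely. Otherwise their union lies in the ideal, and a diagonal sequence
  -- outside it is almost disjoint from all members.
  by_cases h : {A ∈ 𝒜 | ∀ n, (X n ∩ A).Infinite}.Infinite
  · have e := h.natEmbedding
    have hex : ∀ k n, ∃ y ∈ X n ∩ (e k : Set ℕ), n ≤ y :=
      fun k n => ((e k).2.2 n).exists_ge_mem n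
    choose y hy hny using hex
    refine ⟨{m | ∃ n, ∃ k ≤ n, y k n = m}, ?_, ?_, ?_⟩
    · rintro _ ⟨n, k, -, rfl⟩
      exact hanti (Nat.zero_le n) (hy k n).1
    · refine positive_of_infinite_hits had ?_
      refine (infinite_range_of_injective (f := fun n => (e n : Set ℕ))
        fun a b hab => e.injective (Subtype.ext hab)).mono ?_
      rintro _ ⟨k, rfl⟩
      refine ⟨(e k).2.1, infinite_of_not_bddAbove ?_⟩
      rintro ⟨b, hb⟩
      have := hb (a := y k (max k (b + 1))) ⟨⟨_, k, le_max_left _ _, rfl⟩, (hy _ _).2⟩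
      have := hny k (max k (b + 1))
      omega
    · intro n
      refine ((finite_Iio n).biUnion (t := fun m => (fun k => y k m) '' Iic m)
        fun m _ => (finite_Iic m).image _).subset ?_
      rintro _ ⟨⟨m, k, hk, rfl⟩, hn⟩
      refine mem_biUnion (x := m) ?_ ⟨k, hk, rfl⟩
      by_contra hm
      exact hn (hanti (not_lt.1 hm) (hy k m).1)
  · rw [not_infinite] at h
    set U := ⋃₀ {A ∈ 𝒜 | ∀ n, (X n ∩ A).Infinite} with hU
    have hUI : U ∈ genIdeal 𝒜 := ⟨_, sep_subset _ _, h, by simp [hU]⟩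
    have hX' : ∀ n, ∃ y ∈ X n \ U, n ≤ y := fun n =>
      (infinite_of_positive (positive_diff (hX n) hUI)).exists_ge_mem n
    choose y hy hny using hX'
    have hYX : ∀ n, (range y \ X n).Finite := by
      intro n
      refine ((finite_Iio n).image y).subset ?_
      rintro _ ⟨⟨m, rfl⟩, hm⟩
      refine ⟨m, ?_, rfl⟩
      by_contra hmn
      exact hm (hanti (not_lt.1 hmn) (hy m).1)
    refine ⟨range y, ?_, positive_of_almostDisjoint ?_ ?_, hYX⟩
    · rintro _ ⟨n, rfl⟩
      exact hanti (Nat.zero_le n) (hy n).1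
    · refine infinite_of_not_bddAbove ?_
      rintro ⟨b, hb⟩
      have := hb (mem_range_self (b + 1))
      have := hny (b + 1)
      omega
    · intro A hA
      by_cases hAX : ∀ n, (X n ∩ A).Infinite
      · refine Set.finite_empty.subset ?_
        rintro _ ⟨⟨n, rfl⟩, hn⟩
        exact (hy n).2 ⟨A, ⟨hA, hAX⟩, hn⟩
      · push Not at hAX
        obtain ⟨n, hn⟩ := hAX
        refine ((hYX n).union hn).subset ?_
        rintro m ⟨hm, hmA⟩
        by_cases hmX : m ∈ X n
        · exact Or.inr ⟨hmX, hmA⟩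
        · exact Or.inl ⟨hm, hmX⟩

lemma IsAD.mono (h : IsAD ℬ) (hsub : 𝒜 ⊆ ℬ) : IsAD 𝒜 :=
  ⟨fun A hA => h.1 A (hsub hA), h.2.mono hsub⟩

/-- An infinite almost disjoint family with fewer than `𝔞` members is not maximal. -/
lemma exists_almostDisjoint_of_card_lt (had : IsAD 𝒜) (hinf : 𝒜.Infinite)
    (hcard : #𝒜 < almostDisjointnessNumber) :
    ∃ Z : Set ℕ, Z.Infinite ∧ ∀ A ∈ 𝒜, (Z ∩ A).Finite := by
  by_contra! hcon
  refine (notMem_of_lt_csInf' hcard) ⟨𝒜, ⟨hinf, had, ?_⟩, rfl⟩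
  intro ℬ hℬ hsub B hB
  by_contra hBA
  obtain ⟨A, hA, h⟩ := hcon B (hℬ.1 B hB)
  exact h (hℬ.2 hB (hsub hA) fun h => hBA (h ▸ hA))

/-- A set that is positive with respect to an almost disjoint family with fewer than `𝔞` members
contains an infinite set that is almost disjoint from the family. -/
lemma exists_subset_almostDisjoint_of_card_lt (had : IsAD 𝒜)
    (hcard : #𝒜 < almostDisjointnessNumber) (hX : X ∈ positiveSets 𝒜) :
    ∃ Z ⊆ X, Z.Infinite ∧ ∀ A ∈ 𝒜, (Z ∩ A).Finite := by
  rcases exists_almostDisjoint_or_infinite_hits hX with h | h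
  · exact h
  have hXinf := infinite_of_positive hX
  -- The enumeration of `X` transports the traces on `X` to an infinite almost disjoint family on
  -- `ω`, to which the definition of `𝔞` applies.
  let φ : ℕ → ℕ := Nat.nth (· ∈ X)
  have hφ : Function.Injective φ := Nat.nth_injective hXinf
  have hran : range φ = X := Nat.range_nth_of_infinite hXinf
  have hpre : ∀ A : Set ℕ, φ '' (φ ⁻¹' A) = X ∩ A := fun A => by
    rw [image_preimage_eq_inter_range, hran, inter_comm]
  set 𝒟 := (fun A => φ ⁻¹' A) '' {A ∈ 𝒜 | (X ∩ A).Infinite} with h𝒟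
  have hinj : InjOn (fun A => φ ⁻¹' A) {A ∈ 𝒜 | (X ∩ A).Infinite} := by
    intro A hA B hB hAB
    by_contra hne
    refine hA.2 ((had.2 hA.1 hB.1 hne).subset fun n hn => ⟨hn.2, ?_⟩)
    have : n ∈ X ∩ B := by
      rw [← hpre, ← show φ ⁻¹' A = φ ⁻¹' B from hAB, hpre]; exact hn
    exact this.2
  obtain ⟨Z, hZ, hZA⟩ : ∃ Z : Set ℕ, Z.Infinite ∧ ∀ A ∈ 𝒟, (Z ∩ A).Finite := by
    refine exists_almostDisjoint_of_card_lt ⟨?_, ?_⟩ (h.image hinj) ?_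
    · rintro _ ⟨A, hA, rfl⟩
      refine Infinite.of_image φ ?_
      rw [hpre]; exact hA.2
    · rintro _ ⟨A, hA, rfl⟩ _ ⟨B, hB, rfl⟩ hne
      have : A ≠ B := fun h => hne (h ▸ rfl)
      exact ((had.2 hA.1 hB.1 this).preimage hφ.injOn : (φ ⁻¹' (A ∩ B)).Finite)
    · exact (mk_image_le.trans (mk_le_mk_of_subset (sep_subset _ _))).trans_lt hcard
  refine ⟨φ '' Z, ?_, hZ.image hφ.injOn, fun A hA => ?_⟩
  · rw [← hran]; exact image_subset_range _ _
  · by_cases hXA : (X ∩ A).Infinite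
    · refine ((hZA _ ⟨A, ⟨hA, hXA⟩, rfl⟩).image φ).subset ?_
      rintro _ ⟨⟨z, hz, rfl⟩, hzA⟩
      exact ⟨z, ⟨hz, hzA⟩, rfl⟩
    · refine (not_infinite.1 hXA).subset (inter_subset_inter_left _ ?_)
      rw [← hran]; exact image_subset_range _ _

end Ideal

/-! ### Unsplitting families and the splitting number. -/

section Splitting

/-- A family of sets is unsplitting if it has, below every infinite set, an infinite set that is
split by no member. -/
def IsUnsplitting (𝒮 : Set (Set ℕ)) : Prop :=
  ∀ X : Set ℕ, X.Infinite → ∃ Y ⊆ X, Y.Infinite ∧ ∀ S ∈ 𝒮, ¬ Splits S Y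

lemma Splits.of_almostSubset {S X Y : Set ℕ} (h : Splits S Y) (hYX : (Y \ X).Finite) :
    Splits S X := by
  constructor
  · refine fun hf => h.1 ((hf.union hYX).subset ?_)
    rintro n ⟨hn, hS⟩
    by_cases hX : n ∈ X
    · exact Or.inl ⟨hX, hS⟩
    · exact Or.inr ⟨hn, hX⟩
  · refine fun hf => h.2 ((hf.union hYX).subset ?_)
    rintro n ⟨hn, hS⟩
    by_cases hX : n ∈ X
    · exact Or.inl ⟨hX, hS⟩
    · exact Or.inr ⟨hn, hX⟩

lemma isUnsplitting_singleton (S : Set ℕ) : IsUnsplitting {S} := by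
  intro X hX
  by_cases h : (X ∩ S).Infinite
  · refine ⟨X ∩ S, inter_subset_left, h, ?_⟩
    rintro _ rfl ⟨-, h2⟩
    refine h2 (finite_empty.subset ?_)
    rintro n ⟨⟨-, h⟩, h'⟩
    exact h' h
  · refine ⟨X, Subset.rfl, hX, ?_⟩
    rintro _ rfl ⟨h1, -⟩
    exact h h1

lemma IsUnsplitting.mono {𝒮 𝒯 : Set (Set ℕ)} (h : IsUnsplitting 𝒯) (hsub : 𝒮 ⊆ 𝒯) :
    IsUnsplitting 𝒮 := fun X hX => by
  obtain ⟨Y, hYX, hY, hS⟩ := h X hX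
  exact ⟨Y, hYX, hY, fun S hS' => hS S (hsub hS')⟩

lemma isUnsplitting_of_card_lt {𝒮 : Set (Set ℕ)} (h : #𝒮 < splittingNumber) :
    IsUnsplitting 𝒮 := by
  intro X hX
  let φ : ℕ → ℕ := Nat.nth (· ∈ X)
  have hφ : Function.Injective φ := Nat.nth_injective hX
  have hran : range φ = X := Nat.range_nth_of_infinite hX
  -- Splitting families consist of infinite sets; a finite preimage splits nothing and can be
  -- dropped.
  set 𝒯 : Set (Set ℕ) := {R ∈ (fun S => φ ⁻¹' S) '' 𝒮 | R.Infinite} with h𝒯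
  have hcard : #𝒯 < splittingNumber :=
    ((mk_le_mk_of_subset (sep_subset _ _)).trans mk_image_le).trans_lt h
  have hns : ¬ IsSplittingFamily 𝒯 := fun hs => notMem_of_lt_csInf' hcard ⟨𝒯, hs, rfl⟩
  have : ∃ Y : Set ℕ, Y.Infinite ∧ ∀ S ∈ 𝒯, ¬ Splits S Y := by
    by_contra! hcon
    exact hns ⟨fun S hS => hS.2, hcon⟩
  obtain ⟨Y, hY, hYS⟩ := this
  refine ⟨φ '' Y, ?_, hY.image hφ.injOn, ?_⟩
  · rw [← hran]; exact image_subset_range _ _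
  · intro S hS hsp
    have h1 : (Y ∩ φ ⁻¹' S).Infinite := by
      refine Infinite.of_image φ ?_
      rw [image_inter_preimage]; exact hsp.1
    refine hYS (φ ⁻¹' S) ⟨⟨S, hS, rfl⟩, h1.mono inter_subset_right⟩ ⟨h1, ?_⟩
    refine Infinite.of_image φ ?_
    have : φ '' (Y \ φ ⁻¹' S) = φ '' Y \ S := by
      ext n
      constructor
      · rintro ⟨y, ⟨hy, hyS⟩, rfl⟩
        exact ⟨⟨y, hy, rfl⟩, hyS⟩
      · rintro ⟨⟨y, hy, rfl⟩, hyS⟩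
        exact ⟨y, ⟨hy, hyS⟩, rfl⟩
    rw [this]; exact hsp.2

/-- A diagonal set through successive refinements is almost contained in each of them, and a set
that splits it would split every almost superset. -/
lemma isUnsplitting_iUnion {𝒮 : ℕ → Set (Set ℕ)} (h : ∀ n, IsUnsplitting (𝒮 n)) :
    IsUnsplitting (⋃ n, 𝒮 n) := by
  intro X hX
  choose! r hrX hr hrS using h
  let Y : ℕ → Set ℕ := fun n => Nat.rec X (fun n Y => r n Y) n
  have hYinf : ∀ n, (Y n).Infinite := fun n => by
    induction n with
    | zero => exact hX
    | succ n ih => exact hr n _ ih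
  have hanti : Antitone Y := antitone_nat_of_succ_le fun n => hrX n _ (hYinf n)
  have hex : ∀ n, ∃ y ∈ Y n, n ≤ y := fun n => (hYinf n).exists_ge_mem n
  choose y hy hny using hex
  refine ⟨range y, ?_, ?_, ?_⟩
  · rintro _ ⟨n, rfl⟩
    exact hanti (Nat.zero_le n) (hy n)
  · refine infinite_of_not_bddAbove ?_
    rintro ⟨b, hb⟩
    have := hb (mem_range_self (b + 1))
    have := hny (b + 1)
    omega
  · intro S hS hsp
    obtain ⟨n, hn⟩ := mem_iUnion.1 hS
    refine hrS n (Y n) (hYinf n) S hn (hsp.of_almostSubset (X := Y (n + 1)) ?_)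
    refine ((finite_Iio (n + 1)).image y).subset ?_
    rintro _ ⟨⟨m, rfl⟩, hm⟩
    refine ⟨m, ?_, rfl⟩
    by_contra hmn
    exact hm (hanti (not_lt.1 hmn) (hy m))

lemma IsUnsplitting.not_isSplittingFamily {𝒮 : Set (Set ℕ)} (h : IsUnsplitting 𝒮) :
    ¬ IsSplittingFamily 𝒮 := fun hs => by
  obtain ⟨Y, -, hY, hS⟩ := h univ infinite_univ
  obtain ⟨S, hS', hsp⟩ := hs.2 Y hY
  exact hS S hS' hsp

lemma exists_isSplittingFamily_card_eq :
    ∃ 𝒮 : Set (Set ℕ), IsSplittingFamily 𝒮 ∧ #𝒮 = splittingNumber := by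
  have hne : {κ | ∃ 𝒮 : Set (Set ℕ), IsSplittingFamily 𝒮 ∧ Cardinal.mk 𝒮 = κ}.Nonempty := by
    refine ⟨_, {S | S.Infinite}, ⟨fun S hS => hS, fun X hX => ?_⟩, rfl⟩
    let φ : ℕ → ℕ := Nat.nth (· ∈ X)
    have hφ : Function.Injective φ := Nat.nth_injective hX
    have hmem : ∀ n, φ n ∈ X := fun n => Nat.nth_mem_of_infinite hX n
    have h1 : (X ∩ range fun n => φ (2 * n)).Infinite := by
      refine (infinite_range_of_injective (f := fun n => φ (2 * n)) fun a b h => ?_).mono ?_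
      · have := hφ h
        omega
      · rintro _ ⟨n, rfl⟩
        exact ⟨hmem _, n, rfl⟩
    refine ⟨range fun n => φ (2 * n), h1.mono inter_subset_right, h1, ?_⟩
    refine (infinite_range_of_injective (f := fun n => φ (2 * n + 1)) fun a b h => ?_).mono ?_
    · have := hφ h
      omega
    · rintro _ ⟨n, rfl⟩
      refine ⟨hmem _, ?_⟩
      rintro ⟨m, hm⟩
      have := hφ hm
      omega
  exact csInf_mem hne

end Splitting

/-! ### Interval partitions: `𝔰 ≤ 𝔡`, and splitting countably many sets at once. -/

section Blocks

/-- Endpoints of an interval partition whose intervals are long with respect to `g`. -/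
def blockEnd (g : ℕ → ℕ) : ℕ → ℕ
  | 0 => 0
  | k + 1 => blockEnd g k + (Finset.range (blockEnd g k + 1)).sup g + 1

variable {g : ℕ → ℕ}

lemma blockEnd_lt_succ (k : ℕ) : blockEnd g k < blockEnd g (k + 1) := by
  simp only [blockEnd]; omega

lemma blockEnd_strictMono : StrictMono (blockEnd g) := strictMono_nat_of_lt_succ blockEnd_lt_succ

lemma lt_blockEnd_succ {k n : ℕ} (h : n ≤ blockEnd g k) : g n < blockEnd g (k + 1) := by
  have : g n ≤ (Finset.range (blockEnd g k + 1)).sup g :=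
    Finset.le_sup (f := g) (Finset.mem_range.2 (by omega))
  simp only [blockEnd]; omega

/-- The union of the intervals with index in `D` in the interval partition given by `g`. -/
def blockUnion (g : ℕ → ℕ) (D : Set ℕ) : Set ℕ :=
  {n | ∃ k ∈ D, blockEnd g k ≤ n ∧ n < blockEnd g (k + 1)}

lemma block_unique {k l n : ℕ} (hk : blockEnd g k ≤ n) (hk' : n < blockEnd g (k + 1))
    (hl : blockEnd g l ≤ n) (hl' : n < blockEnd g (l + 1)) : k = l := by
  have h1 := (blockEnd_strictMono (g := g)).lt_iff_lt.1 (hk.trans_lt hl')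
  have h2 := (blockEnd_strictMono (g := g)).lt_iff_lt.1 (hl.trans_lt hk')
  omega

lemma exists_block (n : ℕ) : ∃ k, blockEnd g k ≤ n ∧ n < blockEnd g (k + 1) := by
  have hex : ∃ k, n < blockEnd g (k + 1) := ⟨n, (blockEnd_strictMono (g := g)).le_apply⟩
  refine ⟨Nat.find hex, ?_, Nat.find_spec hex⟩
  rcases h : Nat.find hex with _ | k
  · exact Nat.zero_le _
  · exact not_lt.1 (Nat.find_min hex (m := k) (by omega))

/-- If a set meets almost all blocks with index in the infinite set `D`, then it has infinite
intersection with the union of these blocks. -/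
lemma infinite_inter_blockUnion {C D : Set ℕ} (hD : D.Infinite) {N : ℕ}
    (h : ∀ k ∈ D, N ≤ k → ∃ c ∈ C, blockEnd g k ≤ c ∧ c < blockEnd g (k + 1)) :
    (C ∩ blockUnion g D).Infinite := by
  refine infinite_of_not_bddAbove ?_
  rintro ⟨b, hb⟩
  obtain ⟨k, hk, hkb⟩ := hD.exists_gt (max N b)
  obtain ⟨c, hc, h1, h2⟩ := h k hk (by omega)
  have := hb ⟨hc, k, hk, h1, h2⟩
  have := (blockEnd_strictMono (g := g)).le_apply (x := k)
  omega

lemma disjoint_blockUnion {D E : Set ℕ} (h : Disjoint D E) :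
    Disjoint (blockUnion g D) (blockUnion g E) := by
  rw [disjoint_left] at h ⊢
  rintro n ⟨k, hk, h1, h2⟩ ⟨l, hl, h3, h4⟩
  exact h hk (block_unique h1 h2 h3 h4 ▸ hl)

/-- A family of fewer than `𝔰` functions is not dominating. -/
lemma exists_undominated {J : Type} (G : J → ℕ → ℕ) (hJ : #J < splittingNumber) :
    ∃ h : ℕ → ℕ, ∀ j, ∃ᶠ n in atTop, G j n < h n := by
  -- Take `X` unsplit by the unions of even blocks. If `G j` eventually bounded a next-element
  -- function of `X`, then `X` would meet almost all blocks, even and odd, and be split.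
  have hcard : #(range fun j => blockUnion (G j) {k | Even k}) < splittingNumber :=
    mk_range_le.trans_lt hJ
  obtain ⟨X, -, hX, hXS⟩ := isUnsplitting_of_card_lt hcard univ infinite_univ
  have hex : ∀ n, ∃ x ∈ X, n ≤ x := fun n => hX.exists_ge_mem n
  choose h hhX hn using hex
  refine ⟨h, fun j hcon => hXS _ ⟨j, rfl⟩ ?_⟩
  simp only [not_lt, eventually_atTop] at hcon
  obtain ⟨N, hN⟩ := hcon
  have hit : ∀ k, N ≤ k → ∃ c ∈ X, blockEnd (G j) k ≤ c ∧ c < blockEnd (G j) (k + 1) :=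
    fun k hk => ⟨h (blockEnd (G j) k), hhX _, hn _,
      (hN _ (hk.trans (blockEnd_strictMono (g := G j)).le_apply)).trans_lt
        (lt_blockEnd_succ le_rfl)⟩
  have hodd : {k : ℕ | Odd k}.Infinite := Nat.frequently_atTop_iff_infinite.1 Nat.frequently_odd
  have heven : {k : ℕ | Even k}.Infinite := Nat.frequently_atTop_iff_infinite.1 Nat.frequently_even
  refine ⟨infinite_inter_blockUnion heven fun k _ hk => hit k hk,
    (infinite_inter_blockUnion (g := G j) hodd fun k _ hk => hit k hk).mono ?_⟩
  rintro n ⟨hn, hnD⟩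
  refine ⟨hn, fun hn' => ?_⟩
  have : Disjoint {k : ℕ | Even k} {k : ℕ | Odd k} :=
    disjoint_left.2 fun k hk hk' => (Nat.not_even_iff_odd.2 hk') hk
  exact disjoint_left.1 (disjoint_blockUnion (g := G j) this) hn' hnD

/-- Sets built from an unbounded family of functions and a splitting family split countably many
infinite sets at once. -/
lemma exists_blockUnion_splits {ι : Type*} {G : ι → ℕ → ℕ}
    (hG : ∀ H : ℕ → ℕ, ∃ β, ∃ᶠ n in atTop, H n < G β n) {𝒮 : Set (Set ℕ)}
    (hS : IsSplittingFamily 𝒮) {C : ℕ → Set ℕ} (hC : ∀ n, (C n).Infinite) :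
    ∃ β, ∃ S ∈ 𝒮, ∀ n, Splits (blockUnion (G β) S) (C n) := by
  have hex : ∀ m n, ∃ c ∈ C n, m ≤ c := fun m n => (hC n).exists_ge_mem m
  choose c hcC hmc using hex
  let H : ℕ → ℕ := fun m => m + (Finset.range (m + 1)).sup (c m) + 1
  have hH : ∀ m, m ≤ H m := fun m => by simp only [H]; omega
  have hcH : ∀ m n, n ≤ m → c m n < H m := fun m n hn => by
    have : c m n ≤ (Finset.range (m + 1)).sup (c m) :=
      Finset.le_sup (f := c m) (Finset.mem_range.2 (by omega))
    simp only [H]; omega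
  -- The interval from `m` to `H m` meets `C 0, …, C m`. Iterating `H` twice provides two adjacent
  -- such intervals; whatever block `n` lies in, one of them fits inside that block or the next.
  obtain ⟨β, hβ⟩ := hG fun n => H (H n)
  set u := blockEnd (G β) with hu
  have hmono : StrictMono u := blockEnd_strictMono
  let D : Set ℕ := {k | ∃ m, u k ≤ m ∧ H m ≤ u (k + 1)}
  have hD : D.Infinite := by
    refine infinite_of_not_bddAbove ?_
    rintro ⟨b, hb⟩
    obtain ⟨n, hn, hnG⟩ := (frequently_atTop.1 hβ) (u (b + 1))
    obtain ⟨k, hk, hk'⟩ := exists_block (g := G β) n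
    rw [← hu] at hk hk'
    have hbk : b + 1 < k + 1 := hmono.lt_iff_lt.1 (hn.trans_lt hk')
    have hlast : H (H n) < u (k + 2) := hnG.trans (lt_blockEnd_succ hk'.le)
    rcases le_or_gt (H n) (u (k + 1)) with h | h
    · have := hb (a := k) ⟨n, hk, h⟩
      omega
    · have := hb (a := k + 1) ⟨H n, h.le, hlast.le⟩
      omega
  have hit : ∀ n, ∀ k ∈ D, n ≤ k → ∃ x ∈ C n, u k ≤ x ∧ x < u (k + 1) := by
    rintro n k ⟨m, hm, hm'⟩ hnk
    refine ⟨c m n, hcC _ _, hm.trans (hmc _ _), (hcH m n ?_).trans_le hm'⟩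
    exact hnk.trans (hmono.le_apply.trans hm)
  obtain ⟨S, hSS, hsp⟩ := hS.2 D hD
  refine ⟨β, S, hSS, fun n => ⟨?_, ?_⟩⟩
  · refine (infinite_inter_blockUnion (g := G β) hsp.1
      fun k hk hnk => hit n k hk.1 hnk).mono (inter_subset_inter_right _ ?_)
    rintro x ⟨k, hk, h⟩
    exact ⟨k, hk.2, h⟩
  · refine (infinite_inter_blockUnion (g := G β) hsp.2
      fun k hk hnk => hit n k hk.1 hnk).mono ?_
    rintro x ⟨hx, hxD⟩
    refine ⟨hx, fun hx' => disjoint_left.1 (disjoint_blockUnion (g := G β)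
      (disjoint_left.2 ?_)) hx' hxD⟩
    rintro k hk ⟨-, hk'⟩
    exact hk' hk

end Blocks

lemma isUnsplitting_of_countable {𝒮 : Set (Set ℕ)} (h : 𝒮.Countable) : IsUnsplitting 𝒮 := by
  rcases 𝒮.eq_empty_or_nonempty with rfl | hne
  · exact (isUnsplitting_singleton ∅).mono (empty_subset _)
  · obtain ⟨f, rfl⟩ := h.exists_eq_range hne
    refine (isUnsplitting_iUnion fun n => isUnsplitting_singleton (f n)).mono ?_
    rintro _ ⟨n, rfl⟩
    exact mem_iUnion.2 ⟨n, rfl⟩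

lemma aleph0_lt_splittingNumber : ℵ₀ < splittingNumber := by
  obtain ⟨𝒮, hS, hcard⟩ := exists_isSplittingFamily_card_eq
  by_contra! h
  rw [← hcard, le_aleph0_iff_set_countable] at h
  exact (isUnsplitting_of_countable h).not_isSplittingFamily hS

/-! ### Moves that escape fewer than `𝔰` obstacles. -/

section Run

/-- In a game with countably many positions, in which the moves at a position `θ` (after a binary
choice `i`) are the elements of the infinite set `Z θ i`, moves can be prescribed in such a way
that every play makes, infinitely often, moves outside of any finitely many of fewer than `𝔰`
given sets, provided that these sets are almost disjoint from the sets of moves. -/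
lemma exists_moves {Θ J : Type} [Countable Θ] (hJ : #J < splittingNumber)
    {Z : Θ → Bool → Set ℕ} (hZ : ∀ θ i, (Z θ i).Infinite) (next : Θ → Bool → ℕ → Θ)
    {M : J → Θ → Bool → Set ℕ} (hM : ∀ j θ i, (Z θ i ∩ M j θ i).Finite) :
    ∃ move : ℕ → Θ → Bool → ℕ, (∀ n θ i, move n θ i ∈ Z θ i ∧ n ≤ move n θ i) ∧
      ∀ (x : ℕ → Bool) (run : ℕ → Θ),
        (∀ n, run (n + 1) = next (run n) (x n) (move n (run n) (x n))) →
        ∀ E : List J, ∃ᶠ n in atTop, ∀ j ∈ E, move n (run n) (x n) ∉ M j (run n) (x n) := by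
  classical
  have hex : ∀ m θ i, ∃ a ∈ Z θ i, m ≤ a := fun m θ i => (hZ θ i).exists_ge_mem m
  choose p hpZ hmp using hex
  have hbound : ∀ (E : List J) θ i, ∃ b, ∀ j ∈ E, ∀ a ∈ Z θ i ∩ M j θ i, a < b := by
    intro E θ i
    have hfin : (⋃ j ∈ {j | j ∈ E}, Z θ i ∩ M j θ i).Finite :=
      (List.finite_toSet E).biUnion fun j _ => hM j θ i
    obtain ⟨b, hb⟩ := hfin.bddAbove
    exact ⟨b + 1, fun j hj a ha => Nat.lt_succ_of_le (hb (mem_biUnion hj ha))⟩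
  choose g hg using hbound
  -- The positions reachable from `θ` in `k` moves `p m` with `m` below the bound `g`; finiteness of
  -- this set makes `G` well defined.
  let reach : List J → Θ → ℕ → Finset Θ := fun E θ k => Nat.rec {θ} (fun _ R =>
    R.biUnion fun θ' => Finset.univ.biUnion fun i : Bool =>
      (Finset.range (g E θ' i)).image fun m => next θ' i (p m θ' i)) k
  let G : List J × Θ × ℕ → ℕ → ℕ := fun c n =>
    (reach c.1 c.2.1 (n - c.2.2)).sup fun θ' => max (g c.1 θ' false) (g c.1 θ' true)
  have hcard : #(List J × Θ × ℕ) < splittingNumber := by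
    rw [mk_prod, lift_id, lift_id]
    refine mul_lt_of_lt aleph0_lt_splittingNumber.le
      ((mk_list_le_max J).trans_lt (max_lt aleph0_lt_splittingNumber hJ))
      ((mk_le_aleph0 (α := Θ × ℕ)).trans_lt aleph0_lt_splittingNumber)
  obtain ⟨h, hh⟩ := exists_undominated G hcard
  -- If from stage `N` on every move hit an obstacle from `E`, all indices would stay below `g`, the
  -- play would stay in `reach`, and `G` would bound `h` from `N` on.
  refine ⟨fun n θ i => p (max (h n) n) θ i,
    fun n θ i => ⟨hpZ _ _ _, (le_max_right _ _).trans (hmp _ _ _)⟩, ?_⟩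
  intro x run hrun E hcon
  obtain ⟨N, hN⟩ := eventually_atTop.1 hcon
  have hlt : ∀ n, N ≤ n → max (h n) n < g E (run n) (x n) := by
    intro n hn
    have := hN n hn
    push Not at this
    obtain ⟨j, hj, hmem⟩ := this
    exact (hmp _ _ _).trans_lt (hg E _ _ j hj _ ⟨hpZ _ _ _, hmem⟩)
  have hreach : ∀ k, run (N + k) ∈ reach E (run N) k := by
    intro k
    induction k with
    | zero => exact Finset.mem_singleton_self _
    | succ k ih =>
      refine Finset.mem_biUnion.2 ⟨_, ih, Finset.mem_biUnion.2 ⟨x (N + k), Finset.mem_univ _,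
        Finset.mem_image.2 ⟨max (h (N + k)) (N + k), ?_, ?_⟩⟩⟩
      · exact Finset.mem_range.2 (hlt _ (Nat.le_add_right _ _))
      · rw [← Nat.add_assoc, hrun]
  obtain ⟨n, hn, hG⟩ := frequently_atTop.1 (hh (E, run N, N)) N
  refine hG.not_ge ?_
  have hr := hreach (n - N)
  rw [Nat.add_sub_cancel' hn] at hr
  have h1 : max (g E (run n) false) (g E (run n) true) ≤ G (E, run N, N) n :=
    Finset.le_sup (f := fun θ' => max (g E θ' false) (g E θ' true)) hr
  have h2 : h n < g E (run n) (x n) := (le_max_left _ _).trans_lt (hlt n hn)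
  refine le_trans ?_ h1
  cases hx : x n <;> rw [hx] at h2
  · exact h2.le.trans (le_max_left _ _)
  · exact h2.le.trans (le_max_right _ _)

end Run

/-! ### Branches from chains of nodes. -/

section Branch

/-- An increasing chain of nodes of a tree determines a branch. -/
lemma exists_branch {T : Descriptive.tree ℕ} {t : ℕ → List ℕ} {a : ℕ → ℕ}
    (hT : ∀ n, t n ++ [a n] ∈ T) (hchain : ∀ n, t n ++ [a n] <+: t (n + 1)) :
    ∃ f ∈ treeBranches T, range a ⊆ range f := by
  have hlen : ∀ n, n ≤ (t n).length := by
    intro n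
    induction n with
    | zero => exact Nat.zero_le _
    | succ n ih =>
      have := (hchain n).length_le
      simp only [List.length_append, List.length_singleton] at this
      omega
  have hsucc : ∀ n, t n <+: t (n + 1) := fun n => (List.prefix_append _ _).trans (hchain n)
  have hmono : ∀ m n, m ≤ n → t m <+: t n := by
    intro m n hmn
    induction n, hmn using Nat.le_induction with
    | base => exact List.prefix_rfl
    | succ n _ ih => exact ih.trans (hsucc n)
  let f : ℕ → ℕ := fun k => (t (k + 1)).getD k 0
  have hf : ∀ n k, k < (t n).length → (t n).getD k 0 = f k := by
    intro n k hk
    have hk' : k < (t (k + 1)).length := hlen (k + 1)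
    rcases le_total n (k + 1) with h | h
    · simp only [f]
      rw [List.getD_eq_getElem _ _ hk, List.getD_eq_getElem _ _ hk', (hmono _ _ h).getElem hk]
    · simp only [f]
      rw [List.getD_eq_getElem _ _ hk, List.getD_eq_getElem _ _ hk', (hmono _ _ h).getElem hk']
  have hinit : ∀ n, initSeg f n <+: t n := by
    intro n
    rw [List.prefix_iff_eq_take]
    refine List.ext_getElem ?_ fun k h1 h2 => ?_
    · simp [initSeg, hlen n]
    · have hk : k < n := by simpa [initSeg] using h1
      have hk' : k < (t n).length := hk.trans_le (hlen n)
      simp only [initSeg, List.getElem_map, List.getElem_range, List.getElem_take]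
      rw [← hf n k hk', List.getD_eq_getElem _ _ hk']
  refine ⟨f, fun n => ?_, ?_⟩
  · obtain ⟨r, hr⟩ := (hinit n).trans (List.prefix_append (t n) [a n])
    exact Descriptive.Tree.mem_of_append (y := r) (hr ▸ hT n)
  · rintro _ ⟨n, rfl⟩
    have h1 := (hchain n).length_le
    simp only [List.length_append, List.length_singleton] at h1
    refine ⟨(t n).length, ?_⟩
    rw [← hf (n + 1) _ (by omega), List.getD_eq_getElem _ _ (by omega),
      ← (hchain n).getElem (by simp)]
    simp

end Branch

/-! ### The case `𝔞 < 𝔰`. -/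

section SmallMAD

/-- Members of countably many infinite sets can be chosen to be distinct. -/
lemma exists_injective_choice {Θ α : Type*} [Countable Θ] {C : Θ → Set α}
    (hC : ∀ θ, (C θ).Infinite) : ∃ c : Θ → α, Function.Injective c ∧ ∀ θ, c θ ∈ C θ := by
  classical
  obtain ⟨φ, hφ⟩ := exists_injective_nat Θ
  have key : ∀ (s : Set Θ) (u : Θ → α) (θ : Θ), s.Finite → ∃ a ∈ C θ, ∀ η ∈ s, u η ≠ a := by
    intro s u θ hs
    obtain ⟨a, ha, hna⟩ := ((hC θ).sdiff (hs.image u)).nonempty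
    exact ⟨a, ha, fun η hη h => hna ⟨η, hη, h⟩⟩
  have hfin : ∀ θ, {η | φ η < φ θ}.Finite := fun θ =>
    (finite_Iio (φ θ)).preimage hφ.injOn
  have hwf : WellFounded fun η θ : Θ => φ η < φ θ := (measure φ).wf
  obtain ⟨a0⟩ : Nonempty (Θ → α) := ⟨fun θ => (hC θ).nonempty.some⟩
  -- The filler `a0` occurs only at indices that are not earlier than `θ`, where nothing is
  -- compared.
  let c : Θ → α := hwf.fix fun θ rec =>
    (key {η | φ η < φ θ} (fun η => if h : φ η < φ θ then rec η h else a0 η) θ (hfin θ)).choose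
  have hc : ∀ θ, c θ ∈ C θ ∧ ∀ η, φ η < φ θ → c η ≠ c θ := by
    intro θ
    have := (key {η | φ η < φ θ} (fun η => if h : φ η < φ θ then c η else a0 η) θ
      (hfin θ)).choose_spec
    have heq : c θ = (key {η | φ η < φ θ} (fun η => if h : φ η < φ θ then c η else a0 η) θ
      (hfin θ)).choose := hwf.fix_eq _ θ
    rw [← heq] at this
    refine ⟨this.1, fun η hη => ?_⟩
    simpa [hη] using this.2 η hη
  refine ⟨c, fun θ η h => ?_, fun θ => (hc θ).1⟩
  rcases lt_trichotomy (φ θ) (φ η) with hlt | heq | hlt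
  · exact absurd h ((hc η).2 θ hlt)
  · exact hφ heq
  · exact absurd h.symm ((hc θ).2 η hlt)

lemma IsMAD.exists_infinite_inter {𝒜 : Set (Set ℕ)} (h : IsMAD 𝒜) {X : Set ℕ}
    (hX : X.Infinite) : ∃ A ∈ 𝒜, (X ∩ A).Infinite := by
  by_contra! hcon
  have had : IsAD (insert X 𝒜) := by
    refine ⟨?_, ?_⟩
    · rintro A (rfl | hA)
      · exact hX
      · exact h.2.1.1 A hA
    · refine h.2.1.2.insert fun A hA _ => ⟨hcon A hA, ?_⟩
      rw [inter_comm]; exact hcon A hA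
  have hXA : X ∈ 𝒜 := h.2.2 had (subset_insert _ _) (mem_insert _ _)
  exact hX (by simpa using hcon X hXA)

/-- A MAD family with fewer than `𝔰` members is `+`-Ramsey. -/
lemma IsMAD.isPlusRamsey_of_card_lt {𝒜 : Set (Set ℕ)} (h : IsMAD 𝒜)
    (hcard : #𝒜 < splittingNumber) : IsPlusRamsey 𝒜 := by
  classical
  rintro T ⟨hroot, hT⟩
  have hhits : ∀ s : T, {A ∈ 𝒜 | (treeSucc T s ∩ A).Infinite}.Infinite := by
    intro s
    rcases exists_almostDisjoint_or_infinite_hits (hT s s.2) with ⟨Z, -, hZ, hZA⟩ | h'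
    · obtain ⟨A, hA, hA'⟩ := h.exists_infinite_inter hZ
      exact absurd (hZA A hA) hA'
    · exact h'
  obtain ⟨c, hcinj, hc⟩ := exists_injective_choice hhits
  let next : T → Bool → ℕ → T := fun s _ a =>
    if ha : (s : List ℕ) ++ [a] ∈ T then ⟨s ++ [a], ha⟩ else s
  obtain ⟨move, hmove, hplay⟩ := exists_moves (Θ := T) (J := 𝒜) hcard
    (Z := fun s _ => treeSucc T s ∩ c s) (fun s _ => (hc s).2) next
    -- The moves at `s` lie in `c s`, so this member cannot be an obstacle there.
    (M := fun A s _ => if (A : Set ℕ) = c s then ∅ else A) (by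
      intro A s _
      by_cases hA : (A : Set ℕ) = c s
      · simp [hA]
      · simp only [hA, if_false]
        refine (h.2.1.2 (hc s).1 A.2 (Ne.symm hA)).subset ?_
        rintro n ⟨⟨-, h1⟩, h2⟩
        exact ⟨h1, h2⟩)
  let x : ℕ → Bool := fun _ => true
  let run : ℕ → T := fun n => Nat.rec ⟨[], hroot⟩
    (fun n s => next s (x n) (move n s (x n))) n
  have hrun : ∀ n, run (n + 1) = next (run n) (x n) (move n (run n) (x n)) := fun n => rfl
  let a : ℕ → ℕ := fun n => move n (run n) (x n)
  have haT : ∀ n, (run n).1 ++ [a n] ∈ T := fun n => (hmove n (run n) (x n)).1.1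
  have hsucc : ∀ n, (run (n + 1)).1 = (run n).1 ++ [a n] := fun n => by
    rw [hrun]
    have := haT n
    simp only [next, a] at this ⊢
    rw [dif_pos this]
  have hlen : ∀ n, (run n).1.length = n := fun n => by
    induction n with
    | zero => rfl
    | succ n ih => rw [hsucc]; simp [ih]
  obtain ⟨f, hf, haf⟩ := exists_branch (T := T) (t := fun n => (run n).1) haT
    fun n => (hsucc n).symm ▸ List.prefix_rfl
  refine ⟨f, hf, fun hI => ?_⟩
  obtain ⟨F, hF, hfin, hrange⟩ := mem_genIdeal_of_subset hI haf
  have hruninj : Function.Injective run := fun m n hmn => by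
    have := congrArg (fun s : T => s.1.length) hmn
    simpa [hlen] using this
  -- The nodes of the run are distinct and `c` is injective, so the exempted member belongs to the
  -- finite `F` only finitely often.
  have hev : ∀ᶠ n in atTop, c (run n) ∉ F := by
    have hfin' : {n | c (run n) ∈ F}.Finite :=
      hfin.preimage (f := fun n => c (run n)) (hcinj.comp hruninj).injOn
    have := hfin'.eventually_cofinite_notMem
    rwa [Nat.cofinite_eq_atTop] at this
  obtain ⟨b, hb⟩ := hrange.bddAbove
  obtain ⟨E, hE⟩ : ∃ E : List 𝒜, ∀ A : 𝒜, A ∈ E ↔ (A : Set ℕ) ∈ F := by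
    have : {A : 𝒜 | (A : Set ℕ) ∈ F}.Finite := hfin.preimage Subtype.val_injective.injOn
    exact ⟨this.toFinset.toList, fun A => by simp⟩
  obtain ⟨n, hn, hcF, hbn⟩ :=
    ((hplay x run hrun E).and_eventually (hev.and (eventually_gt_atTop b))).exists
  refine absurd (hb ⟨mem_range_self n, ?_⟩)
    (not_le.2 (hbn.trans_le (hmove n (run n) (x n)).2))
  rintro ⟨A, hA, hnA⟩
  have := hn ⟨A, hF hA⟩ ((hE _).2 hA)
  have hne : A ≠ c (run n) := fun h => hcF (h ▸ hA)
  rw [if_neg hne] at this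
  exact this hnA

end SmallMAD

/-! ### Well-ordered splitting families of length `𝔰`. -/

/-- A well-ordered splitting family `e` of length `𝔰`. It splits infinitely many members of each
sequence of infinite sets on either side; moreover, it either splits all members of each sequence
at once, or its length is less than the bounding number. -/
structure SplitSystem (ι : Type) [LinearOrder ι] [WellFoundedLT ι] (e : ι → Set ℕ) : Prop where
  bounded : ∀ u : ℕ → ι, ∃ b, ∀ n, u n < b
  card_Iio : ∀ b : ι, #(Iio b) < splittingNumber
  splits : ∀ X : Set ℕ, X.Infinite → ∃ α, Splits (e α) X
  split : ∀ C : ℕ → Set ℕ, (∀ n, (C n).Infinite) →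
    ∃ α, ∀ i, ∃ᶠ n in atTop, (C n ∩ side (e α) i).Infinite
  split_all_or_dominate :
    (∀ C : ℕ → Set ℕ, (∀ n, (C n).Infinite) → ∃ α, ∀ i n, (C n ∩ side (e α) i).Infinite) ∨
    ∀ G : ι → ℕ → ℕ, ∃ H : ℕ → ℕ, ∀ β, ∀ᶠ n in atTop, G β n ≤ H n

lemma Splits.infinite_inter_side {S X : Set ℕ} (h : Splits S X) (i : Bool) :
    (X ∩ side S i).Infinite := by
  cases i
  · exact h.2
  · exact h.1

lemma splits_iff {S X : Set ℕ} : Splits S X ↔ ∀ i, (X ∩ side S i).Infinite :=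
  ⟨fun h => h.infinite_inter_side, fun h => ⟨h true, h false⟩⟩

/-- If the length of a splitting family is less than the bounding number, then it splits
infinitely many members of each sequence on either side. -/
lemma exists_frequently_split {ι : Type} {e : ι → Set ℕ}
    (he : ∀ X : Set ℕ, X.Infinite → ∃ α, Splits (e α) X)
    (hdom : ∀ G : ι → ℕ → ℕ, ∃ H : ℕ → ℕ, ∀ β, ∀ᶠ n in atTop, G β n ≤ H n)
    {C : ℕ → Set ℕ} (hC : ∀ n, (C n).Infinite) :
    ∃ α, ∀ i, ∃ᶠ n in atTop, (C n ∩ side (e α) i).Infinite := by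
  classical
  by_contra! hcon
  choose i hi using hcon
  have hb : ∀ α n, ∃ b, (C n ∩ side (e α) (i α)).Finite →
      ∀ c ∈ C n ∩ side (e α) (i α), c < b := by
    intro α n
    by_cases h : (C n ∩ side (e α) (i α)).Finite
    · obtain ⟨b, hb⟩ := h.bddAbove
      exact ⟨b + 1, fun _ c hc => Nat.lt_succ_of_le (hb hc)⟩
    · exact ⟨0, fun h' => absurd h' h⟩
  -- Points `y n ∈ C n` beyond a function dominating all `G α` eventually avoid the side `i α`, so
  -- no `e α` would split their range.
  choose G hG using hb
  obtain ⟨H, hH⟩ := hdom G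
  have hex : ∀ n, ∃ y ∈ C n, max n (H n) ≤ y := fun n => (hC n).exists_ge_mem _
  choose y hyC hy using hex
  have hinf : (range y).Infinite := by
    refine infinite_of_not_bddAbove ?_
    rintro ⟨b, hb⟩
    have := hb (mem_range_self (b + 1))
    have := (le_max_left _ _).trans (hy (b + 1))
    omega
  obtain ⟨α, hα⟩ := he _ hinf
  refine hα.infinite_inter_side (i α) ?_
  have hev : ∀ᶠ n in atTop, y n ∉ side (e α) (i α) := by
    filter_upwards [hi α, hH α] with n hn hn' hmem
    have := hG α n hn _ ⟨hyC n, hmem⟩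
    have := (le_max_right _ _).trans (hy n)
    omega
  obtain ⟨N, hN⟩ := eventually_atTop.1 hev
  refine ((finite_Iio N).image y).subset ?_
  rintro _ ⟨⟨n, rfl⟩, hn⟩
  refine ⟨n, ?_, rfl⟩
  by_contra h
  exact hN n (not_lt.1 h) hn

/-- If all families of `𝔰` functions are dominated, any splitting family will do. Otherwise an
unbounded family of size `𝔰` is combined with a splitting family into unions of blocks. -/
theorem exists_splitSystem :
    ∃ (ι : Type) (_ : LinearOrder ι) (_ : WellFoundedLT ι) (e : ι → Set ℕ), SplitSystem ι e := by
  obtain ⟨𝒮, hS, hcard⟩ := exists_isSplittingFamily_card_eq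
  let ι := splittingNumber.ord.ToType
  have hι : #ι = splittingNumber := mk_ord_toType _
  obtain ⟨φ⟩ : Nonempty (ι ≃ 𝒮) := Cardinal.eq.1 (hι.trans hcard.symm)
  have hIio : ∀ b : ι, #(Iio b) < splittingNumber := fun b => by
    have := mk_Iio_lt b (by rw [hι, Ordinal.type_toType])
    rwa [hι] at this
  have hsplit : ∀ X : Set ℕ, X.Infinite → ∃ α, Splits (φ α) X := fun X hX => by
    obtain ⟨S, hS', h⟩ := hS.2 X hX
    exact ⟨φ.symm ⟨S, hS'⟩, by simpa using h⟩
  -- Were a sequence cofinal, the splitting family would be a countable union of families smaller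
  -- than `𝔰`, hence unsplitting.
  have hbdd : ∀ u : ℕ → ι, ∃ b, ∀ n, u n < b := by
    intro u
    by_contra! hcon
    refine IsUnsplitting.not_isSplittingFamily (𝒮 := 𝒮) ?_ hS
    have h1 : IsUnsplitting (⋃ n, (fun β => (φ β : Set ℕ)) '' Iio (u n)) :=
      isUnsplitting_iUnion fun n => isUnsplitting_of_card_lt (mk_image_le.trans_lt (hIio _))
    have h2 : IsUnsplitting (range fun n => (φ (u n) : Set ℕ)) :=
      isUnsplitting_of_countable (countable_range _)
    refine (isUnsplitting_iUnion (𝒮 := fun n => if n = 0 then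
      (⋃ n, (fun β => (φ β : Set ℕ)) '' Iio (u n)) else range fun n => (φ (u n) : Set ℕ))
      fun n => by split_ifs <;> assumption).mono ?_
    intro S hS'
    obtain ⟨n, hn⟩ := hcon (φ.symm ⟨S, hS'⟩)
    rcases hn.lt_or_eq with h | h
    · exact mem_iUnion.2 ⟨0, by simpa using ⟨n, _, h, by simp⟩⟩
    · exact mem_iUnion.2 ⟨1, by simpa using ⟨n, by simp [← h]⟩⟩
  by_cases hdom : ∀ G : ι → ℕ → ℕ, ∃ H : ℕ → ℕ, ∀ β, ∀ᶠ n in atTop, G β n ≤ H n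
  · exact ⟨ι, inferInstance, inferInstance, fun α => φ α, hbdd, hIio, hsplit,
      fun C hC => exists_frequently_split hsplit hdom hC, Or.inr hdom⟩
  · push Not at hdom
    obtain ⟨G, hG⟩ := hdom
    obtain ⟨ψ⟩ : Nonempty (ι ≃ ι × 𝒮) := Cardinal.eq.1 (by
      rw [mk_prod, lift_id, lift_id, hι, hcard, mul_eq_self aleph0_lt_splittingNumber.le])
    let e : ι → Set ℕ := fun α => blockUnion (G (ψ α).1) (ψ α).2
    have hall : ∀ C : ℕ → Set ℕ, (∀ n, (C n).Infinite) →
        ∃ α, ∀ i n, (C n ∩ side (e α) i).Infinite := by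
      intro C hC
      obtain ⟨β, S, hS', h⟩ := exists_blockUnion_splits (G := G)
        (fun H => by simpa using hG H) hS hC
      refine ⟨ψ.symm (β, ⟨S, hS'⟩), fun i n => ?_⟩
      simpa [e] using (h n).infinite_inter_side i
    refine ⟨ι, inferInstance, inferInstance, e, hbdd, hIio, fun X hX => ?_, fun C hC => ?_,
      Or.inl hall⟩
    · obtain ⟨α, hα⟩ := hall (fun _ => X) fun _ => hX
      exact ⟨α, splits_iff.2 fun i => hα i 0⟩
    · obtain ⟨α, hα⟩ := hall C hC
      exact ⟨α, fun i => Frequently.of_forall fun n => hα i n⟩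

/-! ### Fresh tags by counting branches. -/

section FreshBranch

variable {ι : Type} [LinearOrder ι] [WellFoundedLT ι]

/-- Among the branches of a binary scheme of functions `τ` on initial segments of `ι` there is one
that is extended by none of fewer than continuum many given tags. -/
lemma exists_fresh_branch (hbdd : ∀ u : ℕ → ι, ∃ b, ∀ n, u n < b) {Γ : Type} (hΓ : #Γ < 𝔠)
    (L : Γ → ι) (S : Γ → ι → Bool) {α : (ℕ → Bool) → ℕ → ι} {τ : (ℕ → Bool) → ℕ → ι → Bool}
    (hloc : ∀ x y n, (∀ m < n, x m = y m) → α x n = α y n)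
    (hα : ∀ x n, α x n < α x (n + 1))
    (hτ : ∀ x n, ∀ β < α x n, τ x (n + 1) β = τ x n β)
    (hsplit : ∀ x n, τ x (n + 1) (α x n) = x n) :
    ∃ (x : ℕ → Bool) (l : ι) (t : ι → Bool),
      (∀ n, ∀ β < α x n, β < l ∧ t β = τ x n β) ∧ (∀ β < l, ∃ n, β < α x n) ∧
      ∀ γ, ¬ (l ≤ L γ ∧ ∀ β < l, S γ β = t β) := by
  classical
  have hmono : ∀ x, StrictMono (α x) := fun x => strictMono_nat_of_lt_succ (hα x)
  have hcoh : ∀ x m n, m ≤ n → ∀ β < α x m, τ x n β = τ x m β := by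
    intro x m n hmn
    induction n, hmn using Nat.le_induction with
    | base => exact fun _ _ => rfl
    | succ n hn ih =>
      intro β hβ
      rw [hτ x n β (hβ.trans_le ((hmono x).monotone hn)), ih β hβ]
  have hl : ∀ x, ∃ l, (∀ n, α x n < l) ∧ ∀ β < l, ∃ n, β < α x n := by
    intro x
    let B : Set ι := {b | ∀ n, α x n < b}
    have hne : B.Nonempty := hbdd (α x)
    refine ⟨wellFounded_lt.min B hne, wellFounded_lt.min_mem B hne, fun β hβ => ?_⟩
    have hnot : β ∉ B := fun h => wellFounded_lt.not_lt_min B h hβ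
    simp only [B, mem_ofPred_eq, not_forall, not_lt] at hnot
    obtain ⟨n, hn⟩ := hnot
    exact ⟨n + 1, hn.trans_lt (hα x n)⟩
  choose l hαl hl using hl
  let t : (ℕ → Bool) → ι → Bool := fun x β =>
    if h : ∃ n, β < α x n then τ x (Nat.find h) β else true
  have ht : ∀ x n, ∀ β < α x n, t x β = τ x n β := by
    intro x n β hβ
    have h : ∃ n, β < α x n := ⟨n, hβ⟩
    simp only [t, dif_pos h]
    exact (hcoh x _ _ (Nat.find_min' h hβ) β (Nat.find_spec h)).symm
  suffices h : ∃ x, ∀ γ, ¬ (l x ≤ L γ ∧ ∀ β < l x, S γ β = t x β) by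
    obtain ⟨x, hx⟩ := h
    exact ⟨x, l x, t x, fun n β hβ => ⟨hβ.trans (hαl x n), ht x n β hβ⟩, hl x, hx⟩
  by_contra! hcon
  choose γ hγL hγ using hcon
  -- At the first difference `n` of `x` and `y`, the indices `α x n = α y n` coincide while the tags
  -- disagree there, so no single tag extends both. Thus `2^ω` would embed into `Γ`.
  have hinj : Function.Injective γ := by
    intro x y hxy
    by_contra hne
    have hex : ∃ n, x n ≠ y n := Function.ne_iff.1 hne
    set n := Nat.find hex with hn
    have hα' : α x n = α y n := hloc x y n fun m hm => not_not.1 (Nat.find_min hex hm)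
    have h1 := hγ x (α x n) (hαl x n)
    have h2 := hγ y (α x n) (hα' ▸ hαl y n)
    rw [ht x (n + 1) _ (hα x n), hsplit] at h1
    rw [ht y (n + 1) _ (hα' ▸ hα y n), hα', hsplit, ← hα', ← hxy, h1] at h2
    exact Nat.find_spec hex h2
  refine (mk_le_of_injective hinj).not_gt ?_
  simpa using hΓ

end FreshBranch

/-! ### Tagged families and fresh subsets of positive sets. -/

section Tagged

variable {ι : Type} [LinearOrder ι] {e : ι → Set ℕ} {𝒜 : Set (Set ℕ)}
  {L : Set ℕ → ι} {S : Set ℕ → ι → Bool} {X : Set ℕ}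

/-- An almost disjoint family of fewer than continuum many sets, each of which carries a tag: the
set `A` is almost contained in the side of `e β` that is given by `S A β`, for all `β < L A`, and
each function on an initial segment of `ι` properly extends the tags of few sets only. -/
structure TaggedFamily (e : ι → Set ℕ) (𝒜 : Set (Set ℕ)) (L : Set ℕ → ι)
    (S : Set ℕ → ι → Bool) : Prop where
  isAD : IsAD 𝒜
  card_lt : #𝒜 < 𝔠
  almost_subset : ∀ A ∈ 𝒜, ∀ β < L A, (A \ side (e β) (S A β)).Finite
  count : ∀ (l : ι) (t : ι → Bool),
    #{A | A ∈ 𝒜 ∧ L A < l ∧ ∀ β < L A, S A β = t β} ≤ max ℵ₀ #(Iio l)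

/-- The tag `(l, t)` is extended by the tag of no member of `𝒜`. -/
def IsFreshTag (𝒜 : Set (Set ℕ)) (L : Set ℕ → ι) (S : Set ℕ → ι → Bool) (l : ι)
    (t : ι → Bool) : Prop :=
  ∀ A ∈ 𝒜, ¬ (l ≤ L A ∧ ∀ β < l, S A β = t β)

/-- A member whose tag is not extended by a fresh tag is incompatible with it. -/
lemma IsFreshTag.exists_ne {l : ι} {t : ι → Bool} (h : IsFreshTag 𝒜 L S l t) {A : Set ℕ}
    (hA : A ∈ 𝒜) (hext : ¬ (L A < l ∧ ∀ β < L A, S A β = t β)) :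
    ∃ β < L A, β < l ∧ S A β = !(t β) := by
  by_contra! hcon
  have hagree : ∀ β < L A, β < l → S A β = t β := by
    intro β h1 h2
    have := hcon β h1 h2
    cases hS : S A β <;> cases ht : t β <;> simp_all
  rcases lt_or_ge (L A) l with h' | h'
  · exact hext ⟨h', fun β hβ => hagree β hβ (hβ.trans h')⟩
  · exact h A hA ⟨h', fun β hβ => hagree β (hβ.trans_le h') hβ⟩

variable [WellFoundedLT ι]

lemma SplitSystem.exists_split_positive (he : SplitSystem ι e) (had : IsAD 𝒜)
    (hX : X ∈ positiveSets 𝒜) : ∃ α, ∀ i, X ∩ side (e α) i ∈ positiveSets 𝒜 := by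
  obtain ⟨C, hC, htest⟩ := exists_positivity_test had hX
  obtain ⟨α, hα⟩ := he.split C hC
  exact ⟨α, fun i => htest _ (hα i)⟩

/-- Every positive set contains an infinite set that is almost disjoint from the family and has a
fresh tag. -/
lemma TaggedFamily.exists_fresh_subset (hT : TaggedFamily e 𝒜 L S) (he : SplitSystem ι e)
    (hsa : splittingNumber ≤ almostDisjointnessNumber) (hX : X ∈ positiveSets 𝒜) :
    ∃ Z ⊆ X, ∃ l t, Z.Infinite ∧ (∀ A ∈ 𝒜, (Z ∩ A).Finite) ∧
      (∀ β < l, (Z \ side (e β) (t β)).Finite) ∧ IsFreshTag 𝒜 L S l t := by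
  classical
  let P : Type := {Y : Set ℕ // Y ∈ positiveSets 𝒜}
  have hne : ∀ Y : P, {α | ∀ i, Y.1 ∩ side (e α) i ∈ positiveSets 𝒜}.Nonempty :=
    fun Y => he.exists_split_positive hT.isAD Y.2
  -- The least index both of whose sides have positive trace on `Y`. Below it exactly one side is
  -- positive, and `τ` records which.
  let α : P → ι := fun Y => wellFounded_lt.min _ (hne Y)
  have hα : ∀ Y i, Y.1 ∩ side (e (α Y)) i ∈ positiveSets 𝒜 :=
    fun Y => wellFounded_lt.min_mem _ (hne Y)
  have hmin : ∀ (Y : P) β, (∀ i, Y.1 ∩ side (e β) i ∈ positiveSets 𝒜) → α Y ≤ β :=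
    fun Y β h => not_lt.1 (wellFounded_lt.not_lt_min
      {α | ∀ i, Y.1 ∩ side (e α) i ∈ positiveSets 𝒜} h)
  let τ : P → ι → Bool := fun Y β => decide (Y.1 ∩ side (e β) true ∈ positiveSets 𝒜)
  have hτI : ∀ Y, ∀ β < α Y, Y.1 ∩ side (e β) (!(τ Y β)) ∈ genIdeal 𝒜 := by
    intro Y β hβ
    by_contra hcon
    refine hβ.not_ge (hmin Y β fun i => ?_)
    by_cases h : Y.1 ∩ side (e β) true ∈ positiveSets 𝒜
    · simp only [τ, h, decide_true, Bool.not_true] at hcon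
      cases i
      · exact hcon
      · exact h
    · simp only [τ, h, decide_false, Bool.not_false] at hcon
      exact absurd hcon h
  have hτeq : ∀ (Y : P) β i, Y.1 ∩ side (e β) (!i) ∈ genIdeal 𝒜 → τ Y β = i := by
    intro Y β i h
    cases i
    · simp only [τ, decide_eq_false_iff_not]
      exact fun h' => h' h
    · simp only [τ, decide_eq_true_eq]
      intro h'
      refine Y.2 (mem_genIdeal_of_subset (union_mem_genIdeal h h') fun n hn => ?_)
      by_cases hs : n ∈ side (e β) true
      · exact Or.inr ⟨hn, hs⟩
      · exact Or.inl ⟨hn, mem_side_not.2 hs⟩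
  let next : P → Bool → P := fun Y i => ⟨Y.1 ∩ side (e (α Y)) i, hα Y i⟩
  have hnextI : ∀ Y i, ∀ β < α Y, (next Y i).1 ∩ side (e β) (!(τ Y β)) ∈ genIdeal 𝒜 :=
    fun Y i β hβ => mem_genIdeal_of_subset (hτI Y β hβ)
      (inter_subset_inter_left _ inter_subset_left)
  have hnextα : ∀ Y i, (next Y i).1 ∩ side (e (α Y)) (!i) ∈ genIdeal 𝒜 := by
    intro Y i
    refine finite_mem_genIdeal (finite_empty.subset ?_)
    rintro n ⟨⟨-, h1⟩, h2⟩
    exact mem_side_not.1 h2 h1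
  have hαlt : ∀ Y i, α Y < α (next Y i) := by
    intro Y i
    by_contra! hle
    rcases hle.lt_or_eq with h | h
    · exact hα (next Y i) _ (hnextI Y i _ h)
    · have := hα (next Y i) (!i)
      rw [h] at this
      exact this (hnextα Y i)
  let run : (ℕ → Bool) → ℕ → P := fun x n => Nat.rec ⟨X, hX⟩ (fun n Y => next Y (x n)) n
  obtain ⟨x, l, t, hlt, hl, hfresh⟩ := exists_fresh_branch he.bounded hT.card_lt
    (fun A => L A.1) (fun A => S A.1) (α := fun x n => α (run x n))
    (τ := fun x n => τ (run x n))
    (fun x y n h => by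
      have : run x n = run y n := by
        induction n with
        | zero => rfl
        | succ n ih =>
          have := ih fun m hm => h m (hm.trans n.lt_succ_self)
          simp only [run] at this ⊢
          rw [this, h n n.lt_succ_self]
      simp only [this])
    (fun x n => hαlt _ _)
    (fun x n β hβ => hτeq _ _ _ (hnextI _ _ _ hβ))
    (fun x n => hτeq _ _ _ (hnextα _ _))
  have hfresh' : IsFreshTag 𝒜 L S l t := fun A hA => hfresh ⟨A, hA⟩
  obtain ⟨Y, hYX, hY, hYn⟩ := exists_positive_pseudoIntersection hT.isAD
    (X := fun n => (run x n).1) (antitone_nat_of_succ_le fun n => inter_subset_left)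
    fun n => (run x n).2
  have hYI : ∀ β < l, Y ∩ side (e β) (!(t β)) ∈ genIdeal 𝒜 := by
    intro β hβ
    obtain ⟨n, hn⟩ := hl β hβ
    rw [(hlt n β hn).2]
    refine mem_genIdeal_of_subset (union_mem_genIdeal (hτI _ β hn)
      (finite_mem_genIdeal (hYn n))) ?_
    rintro m ⟨hm, hm'⟩
    by_cases h : m ∈ (run x n).1
    · exact Or.inl ⟨h, hm'⟩
    · exact Or.inr ⟨hm, h⟩
  choose! F hF𝒜 hFfin hF using hYI
  -- The members to be avoided explicitly: those covering the wrong-side traces, and those whose tag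
  -- is properly extended by `(l, t)`. Every other member lies almost on the opposite side of some
  -- `e β` with `β < l`.
  let ℬ : Set (Set ℕ) :=
    (⋃ β ∈ Iio l, F β) ∪ {A | A ∈ 𝒜 ∧ L A < l ∧ ∀ β < L A, S A β = t β}
  have hℬ𝒜 : ℬ ⊆ 𝒜 := by
    rintro A (hA | hA)
    · obtain ⟨β, hβ, hA⟩ := mem_iUnion₂.1 hA
      exact hF𝒜 β hβ hA
    · exact hA.1
  have hℬcard : #ℬ < almostDisjointnessNumber := by
    refine lt_of_lt_of_le ?_ hsa
    refine (mk_union_le _ _).trans_lt (add_lt_of_lt aleph0_lt_splittingNumber.le ?_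
      ((hT.count l t).trans_lt (max_lt aleph0_lt_splittingNumber (he.card_Iio l))))
    rw [biUnion_eq_iUnion]
    refine (mk_iUnion_le _).trans_lt (mul_lt_of_lt aleph0_lt_splittingNumber.le
      (he.card_Iio l) ?_)
    refine lt_of_le_of_lt (ciSup_le' fun β => ?_) aleph0_lt_splittingNumber
    exact (hFfin β.1 β.2).countable.le_aleph0
  obtain ⟨Z, hZY, hZ, hZℬ⟩ := exists_subset_almostDisjoint_of_card_lt (hT.isAD.mono hℬ𝒜) hℬcard
    (positiveSets_subset hℬ𝒜 hY)
  have hZside : ∀ β < l, (Z \ side (e β) (t β)).Finite := by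
    intro β hβ
    refine ((hF β hβ).union ((hFfin β hβ).biUnion (t := fun A => Z ∩ A) fun A hA =>
      hZℬ A (Or.inl (mem_biUnion hβ hA)))).subset ?_
    rintro n ⟨hn, hns⟩
    by_cases h : n ∈ ⋃₀ F β
    · obtain ⟨A, hA, hnA⟩ := h
      exact Or.inr (mem_biUnion hA ⟨hn, hnA⟩)
    · exact Or.inl ⟨⟨hZY hn, mem_side_not.2 hns⟩, h⟩
  refine ⟨Z, hZY.trans hYX, l, t, hZ, fun A hA => ?_, hZside, hfresh'⟩
  by_cases hext : L A < l ∧ ∀ β < L A, S A β = t β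
  · exact hZℬ A (Or.inr ⟨hA, hext.1, hext.2⟩)
  · obtain ⟨β, hβA, hβl, hne⟩ := hfresh'.exists_ne hA hext
    refine ((hZside β hβl).union (hT.almost_subset A hA β hβA)).subset ?_
    rintro n ⟨hnZ, hnA⟩
    by_cases h : n ∈ side (e β) (t β)
    · refine Or.inr ⟨hnA, ?_⟩
      rw [hne, mem_side_not, not_not]
      exact h
    · exact Or.inl ⟨hnZ, h⟩

end Tagged

/-! ### Sets of nodes with positive branching, and nullness. -/

section Conditions

variable {𝒜 : Set (Set ℕ)} {P Q : Set (List ℕ)} {X : Set ℕ} {s : List ℕ}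

/-- A set of nodes such that above each of its nodes there is a sequence that has positively many
one-point extensions in the set. -/
def IsCondition (𝒜 : Set (Set ℕ)) (P : Set (List ℕ)) : Prop :=
  ∀ s ∈ P, ∃ t, s <+: t ∧ {a | t ++ [a] ∈ P} ∈ positiveSets 𝒜

/-- The set `X` is null above the node `s`: along the nodes of `P` above `s`, only finitely many
steps can be taken in `X` if certain sets in the ideal are avoided. -/
inductive NullAt (𝒜 : Set (Set ℕ)) (P : Set (List ℕ)) (X : Set ℕ) : List ℕ → Prop
  | intro {s : List ℕ} (N : List ℕ → Set ℕ) (hN : ∀ t, N t ∈ genIdeal 𝒜)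
      (h : ∀ t a, s <+: t → a ∈ X → a ∉ N t → t ++ [a] ∈ P → NullAt 𝒜 P X (t ++ [a])) :
      NullAt 𝒜 P X s

lemma NullAt.mono (h : NullAt 𝒜 P X s) (hQ : Q ⊆ P) : NullAt 𝒜 Q X s := by
  induction h with
  | intro N hN _ ih => exact .intro N hN fun t a h1 h2 h3 h4 => ih t a h1 h2 h3 (hQ h4)

/-- Induction on nullness. A sequence `t` has finitely many initial segments, so the ideal sets
belonging to all of them merge into one `M t`; after the first step that escapes, the bound for the
new node takes over. -/
lemma NullAt.exists_bound (h : NullAt 𝒜 P X s) :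
    ∃ M : List ℕ → Set ℕ, (∀ t, M t ∈ genIdeal 𝒜) ∧
      ∀ (t : ℕ → List ℕ) (a : ℕ → ℕ), (∀ n, s <+: t n) → (∀ n, t n ++ [a n] ∈ P) →
        (∀ n, t n ++ [a n] <+: t (n + 1)) → {n | a n ∈ X ∧ a n ∉ M (t n)}.Finite := by
  induction h with
  | @intro s N hN _ ih =>
    have ih' : ∀ u, ∃ M : List ℕ → Set ℕ, (∀ t, M t ∈ genIdeal 𝒜) ∧
        ((∃ t a, u = t ++ [a] ∧ s <+: t ∧ a ∈ X ∧ a ∉ N t ∧ u ∈ P) →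
          ∀ (t : ℕ → List ℕ) (a : ℕ → ℕ), (∀ n, u <+: t n) → (∀ n, t n ++ [a n] ∈ P) →
          (∀ n, t n ++ [a n] <+: t (n + 1)) → {n | a n ∈ X ∧ a n ∉ M (t n)}.Finite) := by
      intro u
      by_cases hu : ∃ t a, u = t ++ [a] ∧ s <+: t ∧ a ∈ X ∧ a ∉ N t ∧ u ∈ P
      · obtain ⟨t, a, rfl, h1, h2, h3, h4⟩ := hu
        obtain ⟨M, hM, hM'⟩ := ih t a h1 h2 h3 h4
        exact ⟨M, hM, fun _ => hM'⟩
      · exact ⟨N, hN, fun h => absurd h hu⟩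
    choose M' hM'I hM' using ih'
    refine ⟨fun t => N t ∪ ⋃ u ∈ {u | u <+: t}, M' u t, fun t => union_mem_genIdeal (hN t)
      (biUnion_mem_genIdeal ?_ fun u _ => hM'I u t), ?_⟩
    · simpa using List.finite_toSet t.inits
    · intro t a hs hP hchain
      by_cases hex : ∃ n, a n ∈ X ∧ a n ∉ N (t n) ∪ ⋃ u ∈ {u | u <+: t n}, M' u (t n)
      · obtain ⟨n, hnX, hn⟩ := hex
        have hpre : ∀ k, t n ++ [a n] <+: t (n + 1 + k) := by
          intro k
          induction k with
          | zero => exact hchain n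
          | succ k ih =>
            exact ih.trans ((List.prefix_append _ _).trans (hchain (n + 1 + k)))
        have hfin := hM' (t n ++ [a n])
          ⟨t n, a n, rfl, hs n, hnX, fun h => hn (Or.inl h), hP n⟩
          (fun k => t (n + 1 + k)) (fun k => a (n + 1 + k)) hpre
          (fun k => hP _) (fun k => hchain _)
        refine ((finite_Iic n).union (hfin.image fun k => n + 1 + k)).subset ?_
        rintro m ⟨hmX, hm⟩
        rcases le_or_gt m n with h | h
        · exact Or.inl h
        · obtain ⟨k, rfl⟩ : ∃ k, m = n + 1 + k := ⟨m - (n + 1), by omega⟩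
          exact Or.inr ⟨k, ⟨hmX, fun h' => hm (Or.inr (mem_biUnion (hpre k) h'))⟩, rfl⟩
      · refine finite_empty.subset fun n hn => (hex ⟨n, hn⟩).elim

/-- If both were null everywhere, a positive set of extensions would contain a point outside both
ideal sets. It lies in `X` or in `Xᶜ`, and one moves on to a smaller rank; the nested induction
rules this out. -/
lemma IsCondition.exists_not_nullAt (hP : IsCondition 𝒜 P) (hne : P.Nonempty) (X : Set ℕ)
    (hX : ∀ s ∈ P, NullAt 𝒜 P X s) : ∃ s ∈ P, ¬ NullAt 𝒜 P Xᶜ s := by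
  by_contra! hXc
  have key : ∀ s, NullAt 𝒜 P X s → s ∉ P := by
    intro s h
    induction h with
    | @intro s N hN _ ih =>
      intro hs
      have inner : ∀ s', NullAt 𝒜 P Xᶜ s' → s <+: s' → s' ∉ P := by
        intro s' h'
        induction h' with
        | @intro s' N' hN' _ ih' =>
          intro hss' hs'
          obtain ⟨t, ht, hpos⟩ := hP s' hs'
          obtain ⟨a, ha, ha'⟩ := (infinite_of_positive (positive_diff hpos
            (union_mem_genIdeal (hN t) (hN' t)))).nonempty
          by_cases haX : a ∈ X
          · exact ih t a (hss'.trans ht) haX (fun h => ha' (Or.inl h)) ha ha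
          · exact ih' t a ht haX (fun h => ha' (Or.inr h)) ha
              ((hss'.trans ht).trans (List.prefix_append _ _)) ha
      exact inner s (hXc s hs) List.prefix_rfl hs
  obtain ⟨s, hs⟩ := hne
  exact key s (hX s hs) hs

/-- The nodes of `P` that end in an element of `X` and above which `X` is not null. -/
def kernel (𝒜 : Set (Set ℕ)) (P : Set (List ℕ)) (X : Set ℕ) : Set (List ℕ) :=
  {u | u ∈ P ∧ (∃ t a, u = t ++ [a] ∧ a ∈ X) ∧ ¬ NullAt 𝒜 P X u}

/-- Otherwise the sets of one-point extensions in the kernel lie in the ideal and witness that `X`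
is null at `s`. -/
lemma exists_positive_kernel (h : ¬ NullAt 𝒜 P X s) :
    ∃ t, s <+: t ∧ {a | t ++ [a] ∈ kernel 𝒜 P X} ∈ positiveSets 𝒜 := by
  classical
  by_contra! hcon
  refine h (.intro (fun t => if s <+: t then {a | t ++ [a] ∈ kernel 𝒜 P X} else ∅)
    (fun t => ?_) fun t a hst haX haN haP => ?_)
  · split_ifs with hst
    · exact not_not.1 (hcon t hst)
    · exact finite_mem_genIdeal finite_empty
  · rw [if_pos hst] at haN
    by_contra hnull
    exact haN ⟨haP, ⟨t, a, rfl, haX⟩, hnull⟩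

lemma isCondition_kernel : IsCondition 𝒜 (kernel 𝒜 P X) := fun _ hs =>
  exists_positive_kernel hs.2.2

lemma kernel_subset : kernel 𝒜 P X ⊆ P := fun _ h => h.1

/-- Everything outside of `X` is null above all nodes for a subset of the kernel. -/
lemma nullAt_of_disjoint {Y : Set ℕ} (hQ : Q ⊆ kernel 𝒜 P X) (hXY : Disjoint X Y) :
    NullAt 𝒜 Q Y s := by
  refine .intro (fun _ => ∅) (fun _ => finite_mem_genIdeal finite_empty) ?_
  intro t a _ haY _ haQ
  obtain ⟨-, ⟨t', a', heq, haX⟩, -⟩ := hQ haQ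
  have : a = a' := by simpa using congrArg List.getLast? heq
  exact (disjoint_left.1 hXY (this ▸ haX) haY).elim

/-- The part of a condition above a node. -/
lemma IsCondition.above (hP : IsCondition 𝒜 P) (r : List ℕ) :
    IsCondition 𝒜 {s | s ∈ P ∧ r <+: s} := by
  rintro s ⟨hs, hrs⟩
  obtain ⟨t, hst, hpos⟩ := hP s hs
  exact ⟨t, hst, positive_of_subset hpos fun a ha =>
    ⟨ha, (hrs.trans hst).trans (List.prefix_append _ _)⟩⟩

end Conditions

/-! ### Splitting a condition into two. -/

section TreeSplitting

variable {ι : Type} [LinearOrder ι] [WellFoundedLT ι] {e : ι → Set ℕ} {𝒜 : Set (Set ℕ)}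
  {P : Set (List ℕ)}

/-- Some member of the splitting family is not null on either side. -/
lemma SplitSystem.exists_split_condition (he : SplitSystem ι e)
    (hfresh : ∀ X ∈ positiveSets 𝒜, ∃ Z ⊆ X, Z.Infinite ∧ ∀ A ∈ 𝒜, (Z ∩ A).Finite)
    (hP : IsCondition 𝒜 P) (hne : P.Nonempty) :
    ∃ α, ∀ i, ∃ s ∈ P, ¬ NullAt 𝒜 P (side (e α) i) s := by
  classical
  choose! Z hZX hZ hZA using hfresh
  have hZI : ∀ X ∈ positiveSets 𝒜, ∀ I ∈ genIdeal 𝒜, (Z X ∩ I).Finite := fun X hX I hI =>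
    finite_inter_of_mem_genIdeal hI (hZA X hX)
  rcases he.split_all_or_dominate with hall | hdom
  -- Once one `e α` splits all `C t`, each side always offers a step that escapes the ideal set,
  -- since `C t` is almost disjoint from it at relevant `t`. So neither side is null at any node of
  -- `P`.
  · let C : List ℕ → Set ℕ := fun t =>
      if {a | t ++ [a] ∈ P} ∈ positiveSets 𝒜 then Z {a | t ++ [a] ∈ P} else univ
    have hC : ∀ t, (C t).Infinite := fun t => by
      simp only [C]
      split_ifs with h
      · exact hZ _ h
      · exact infinite_univ
    obtain ⟨α, hα⟩ := hall (fun n => C (Denumerable.ofNat (List ℕ) n)) fun n => hC _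
    have hα' : ∀ i t, (C t ∩ side (e α) i).Infinite := fun i t => by
      simpa using hα i (Encodable.encode t)
    refine ⟨α, fun i => ?_⟩
    have key : ∀ s, NullAt 𝒜 P (side (e α) i) s → s ∉ P := by
      intro s h
      induction h with
      | @intro s N hN _ ih =>
        intro hs
        obtain ⟨t, hst, hpos⟩ := hP s hs
        have hCt : C t = Z {a | t ++ [a] ∈ P} := if_pos hpos
        obtain ⟨a, ⟨haC, haS⟩, haN⟩ := ((hα' i t).sdiff (hZI _ hpos _ (hN t))).nonempty
        rw [hCt] at haC
        have haP := hZX _ hpos haC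
        exact ih t a hst haS (fun h => haN ⟨haC, h⟩) haP haP
    obtain ⟨s, hs⟩ := hne
    exact ⟨s, hs, fun h => key s h hs⟩
  -- Here each `e β` has a side null throughout `P`, with bounds `M β`. A run whose steps exceed a
  -- function dominating all these bounds enters that side only finitely often, so no `e β` splits
  -- its range.
  · by_contra! hcon
    choose i hi using hcon
    choose! t hst hpos using hP
    obtain ⟨s₀, hs₀⟩ := hne
    choose M hMI hM using fun β => (hi β s₀ hs₀).exists_bound
    have hb : ∀ β s, ∃ b, s ∈ P → ∀ a ∈ Z {a | t s ++ [a] ∈ P} ∩ M β (t s), a < b := by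
      intro β s
      by_cases hs : s ∈ P
      · obtain ⟨b, hb⟩ := (hZI _ (hpos s hs) _ (hMI β (t s))).bddAbove
        exact ⟨b + 1, fun _ a ha => Nat.lt_succ_of_le (hb ha)⟩
      · exact ⟨0, fun h => absurd h hs⟩
    choose g hg using hb
    obtain ⟨H, hH⟩ := hdom fun β n => g β (Denumerable.ofNat (List ℕ) n)
    have hmove : ∀ n s, ∃ a, s ∈ P →
        a ∈ Z {a | t s ++ [a] ∈ P} ∧ max n (H (Encodable.encode s)) ≤ a := by
      intro n s
      by_cases hs : s ∈ P
      · obtain ⟨a, ha, hle⟩ := (hZ _ (hpos s hs)).exists_ge_mem (max n (H (Encodable.encode s)))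
        exact ⟨a, fun _ => ⟨ha, hle⟩⟩
      · exact ⟨0, fun h => absurd h hs⟩
    choose move hmove using hmove
    let run : ℕ → List ℕ := fun n => Nat.rec s₀ (fun n s => t s ++ [move n s]) n
    let a : ℕ → ℕ := fun n => move n (run n)
    have hsucc : ∀ n, run (n + 1) = t (run n) ++ [a n] := fun n => rfl
    have hrunP : ∀ n, run n ∈ P := by
      intro n
      induction n with
      | zero => exact hs₀
      | succ n ih => exact hZX _ (hpos _ ih) (hmove n _ ih).1
    have hpre : ∀ n, s₀ <+: run n := by
      intro n
      induction n with
      | zero => exact List.prefix_rfl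
      | succ n ih => exact (ih.trans (hst _ (hrunP n))).trans (List.prefix_append _ _)
    have hlen : StrictMono fun n => (run n).length := by
      refine strictMono_nat_of_lt_succ fun n => ?_
      have := (hst _ (hrunP n)).length_le
      rw [hsucc, List.length_append, List.length_singleton]
      omega
    have hinj : Function.Injective fun n => Encodable.encode (run n) := fun m n h =>
      hlen.injective (congrArg List.length (Encodable.encode_injective h))
    have hainf : (range a).Infinite := by
      refine infinite_of_not_bddAbove ?_
      rintro ⟨b, hb⟩
      have := hb (mem_range_self (b + 1))
      have := (le_max_left _ _).trans (hmove (b + 1) _ (hrunP (b + 1))).2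
      simp only [a] at *
      omega
    obtain ⟨β, hβ⟩ := he.splits _ hainf
    refine hβ.infinite_inter_side (i β) ?_
    have hfin := hM β (fun n => t (run n)) a (fun n => (hpre n).trans (hst _ (hrunP n)))
      (fun n => hrunP (n + 1)) (fun n => hst _ (hrunP (n + 1)))
    have hev : ∀ᶠ n in atTop, a n ∉ M β (t (run n)) := by
      filter_upwards [hinj.nat_tendsto_atTop.eventually (hH β)] with n hn hmem
      simp only [Denumerable.ofNat_encode] at hn
      have h1 := hg β _ (hrunP n) (a n) ⟨(hmove n _ (hrunP n)).1, hmem⟩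
      have h2 := (le_max_right _ _).trans (hmove n _ (hrunP n)).2
      simp only [a] at *
      omega
    obtain ⟨N, hN⟩ := eventually_atTop.1 hev
    refine (((finite_Iio N).union hfin).image a).subset ?_
    rintro _ ⟨⟨n, rfl⟩, hn⟩
    refine ⟨n, ?_, rfl⟩
    rcases lt_or_ge n N with h | h
    · exact Or.inl h
    · exact Or.inr ⟨hn, hN n h⟩

end TreeSplitting

/-! ### A branch with positive range. -/

section PositiveBranch

variable {ι : Type} [LinearOrder ι] [WellFoundedLT ι] {e : ι → Set ℕ} {𝒜 : Set (Set ℕ)}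
  {L : Set ℕ → ι} {S : Set ℕ → ι → Bool}

/-- A tree whose nodes have positive successor sets has a branch with positive range. -/
theorem TaggedFamily.exists_positive_branch (hT : TaggedFamily e 𝒜 L S) (he : SplitSystem ι e)
    (hsa : splittingNumber ≤ almostDisjointnessNumber) {T : Descriptive.tree ℕ}
    (hTb : IsBranchingTree (positiveSets 𝒜) T) :
    ∃ f ∈ treeBranches T, range f ∈ positiveSets 𝒜 := by
  classical
  have hfresh : ∀ X ∈ positiveSets 𝒜, ∃ Z ⊆ X, Z.Infinite ∧ ∀ A ∈ 𝒜, (Z ∩ A).Finite := by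
    intro X hX
    obtain ⟨Z, hZX, -, -, hZ, hZA, -⟩ := hT.exists_fresh_subset he hsa hX
    exact ⟨Z, hZX, hZ, hZA⟩
  -- A state is a condition together with its least node, the stem.
  let St : Type := {p : Set (List ℕ) × List ℕ //
    IsCondition 𝒜 p.1 ∧ p.2 ∈ p.1 ∧ ∀ s ∈ p.1, p.2 <+: s}
  have hne : ∀ p : St,
      {α | ∀ i, ∃ s ∈ p.1.1, ¬ NullAt 𝒜 p.1.1 (side (e α) i) s}.Nonempty :=
    fun p => he.exists_split_condition hfresh p.2.1 ⟨_, p.2.2.1⟩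
  let α : St → ι := fun p => wellFounded_lt.min _ (hne p)
  have hα : ∀ p i, ∃ s ∈ p.1.1, ¬ NullAt 𝒜 p.1.1 (side (e (α p)) i) s :=
    fun p => wellFounded_lt.min_mem _ (hne p)
  have hmin : ∀ (p : St) β, (∀ i, ∃ s ∈ p.1.1, ¬ NullAt 𝒜 p.1.1 (side (e β) i) s) → α p ≤ β :=
    fun p β h => not_lt.1 (wellFounded_lt.not_lt_min
      {α | ∀ i, ∃ s ∈ p.1.1, ¬ NullAt 𝒜 p.1.1 (side (e α) i) s} h)
  let τ : St → ι → Bool := fun p β =>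
    decide (∃ s ∈ p.1.1, ¬ NullAt 𝒜 p.1.1 (side (e β) true) s)
  have hτnull : ∀ p, ∀ β < α p, ∀ s ∈ p.1.1, NullAt 𝒜 p.1.1 (side (e β) (!(τ p β))) s := by
    intro p β hβ s hs
    by_contra hcon
    by_cases h : ∃ s ∈ p.1.1, ¬ NullAt 𝒜 p.1.1 (side (e β) true) s
    · simp only [τ, h, decide_true, Bool.not_true] at hcon
      refine hβ.not_ge (hmin p β fun i => ?_)
      cases i
      · exact ⟨s, hs, hcon⟩
      · exact h
    · simp only [τ, h, decide_false, Bool.not_false] at hcon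
      exact h ⟨s, hs, hcon⟩
  have hτeq : ∀ (p : St) β i, (∀ s ∈ p.1.1, NullAt 𝒜 p.1.1 (side (e β) (!i)) s) →
      τ p β = i := by
    intro p β i h
    cases i
    · simp only [τ, decide_eq_false_iff_not]
      rintro ⟨s, hs, hns⟩
      exact hns (h s hs)
    · simp only [τ, decide_eq_true_eq]
      have := p.2.1.exists_not_nullAt ⟨_, p.2.2.1⟩ _ h
      rwa [compl_side] at this
  let K : St → Bool → Set (List ℕ) := fun p i => kernel 𝒜 p.1.1 (side (e (α p)) i)
  have hnode : ∀ p i, ∃ t, p.1.2 <+: t ∧ {a | t ++ [a] ∈ K p i} ∈ positiveSets 𝒜 := by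
    intro p i
    obtain ⟨s, hs, hns⟩ := hα p i
    obtain ⟨t, hst, hpos⟩ := exists_positive_kernel hns
    exact ⟨t, (p.2.2.2 s hs).trans hst, hpos⟩
  choose node hroot hpos using hnode
  let next : St → Bool → ℕ → St := fun p i a =>
    if h : node p i ++ [a] ∈ K p i then
      ⟨({s | s ∈ K p i ∧ node p i ++ [a] <+: s}, node p i ++ [a]),
        isCondition_kernel.above _, ⟨h, List.prefix_rfl⟩, fun s hs => hs.2⟩
    else p
  have hnext : ∀ p i a, node p i ++ [a] ∈ K p i →
      (next p i a).1 = ({s | s ∈ K p i ∧ node p i ++ [a] <+: s}, node p i ++ [a]) := by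
    intro p i a h
    simp only [next, dif_pos h]
  have hnextK : ∀ p i a, node p i ++ [a] ∈ K p i → (next p i a).1.1 ⊆ K p i := by
    intro p i a h
    rw [hnext p i a h]
    exact fun s hs => hs.1
  have hnextnull : ∀ p i a, node p i ++ [a] ∈ K p i → ∀ β < α p, ∀ s ∈ (next p i a).1.1,
      NullAt 𝒜 (next p i a).1.1 (side (e β) (!(τ p β))) s := by
    intro p i a h β hβ s hs
    have hsub := (hnextK p i a h).trans kernel_subset
    exact (hτnull p β hβ s (hsub hs)).mono hsub
  have hnextα : ∀ p i a, node p i ++ [a] ∈ K p i → ∀ s ∈ (next p i a).1.1,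
      NullAt 𝒜 (next p i a).1.1 (side (e (α p)) (!i)) s := by
    intro p i a h s _
    refine nullAt_of_disjoint (hnextK p i a h) (disjoint_left.2 fun n h1 h2 => ?_)
    exact mem_side_not.1 h2 h1
  have hαlt : ∀ p i a, node p i ++ [a] ∈ K p i → α p < α (next p i a) := by
    intro p i a h
    by_contra! hle
    rcases hle.lt_or_eq with hlt | heq
    · obtain ⟨s, hs, hns⟩ := hα (next p i a) (!(τ p (α (next p i a))))
      exact hns (hnextnull p i a h _ hlt s hs)
    · obtain ⟨s, hs, hns⟩ := hα (next p i a) (!i)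
      rw [heq] at hns
      exact hns (hnextα p i a h s hs)
  -- positions are coded by histories
  let Θ : Type := List (Bool × ℕ)
  let p₀ : St := ⟨({s | s ∈ T}, []), fun s hs => ⟨s, List.prefix_rfl, hTb.2 s hs⟩, hTb.1,
    fun s _ => List.nil_prefix⟩
  let st : Θ → St := fun θ => θ.foldr (fun c p => next p c.1 c.2) p₀
  choose! Z hZX hZ hZA using hfresh
  let ZZ : Θ → Bool → Set ℕ := fun θ i => Z {a | node (st θ) i ++ [a] ∈ K (st θ) i}
  have hZK : ∀ θ i, ∀ a ∈ ZZ θ i, node (st θ) i ++ [a] ∈ K (st θ) i := fun θ i a ha =>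
    hZX _ (hpos _ _) ha
  -- There are only countably many positions, and countable sets of indices are bounded.
  obtain ⟨b, hb⟩ : ∃ b, ∀ θ, α (st θ) < b := by
    obtain ⟨φ, hφ⟩ := exists_surjective_nat Θ
    obtain ⟨b, hb⟩ := he.bounded fun n => α (st (φ n))
    refine ⟨b, fun θ => ?_⟩
    obtain ⟨n, rfl⟩ := hφ θ
    exact hb n
  -- The branch is not yet known when the moves are fixed, so members compatible with any position
  -- are collected; there are still fewer than `𝔰`.
  let 𝒟 : Set (Set ℕ) := ⋃ θ : Θ, {A | A ∈ 𝒜 ∧ L A < b ∧ ∀ β < L A, S A β = τ (st θ) β}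
  have hμ : max ℵ₀ #(Iio b) < splittingNumber := max_lt aleph0_lt_splittingNumber (he.card_Iio b)
  have hJ : #((Θ × Iio b) ⊕ 𝒟) < splittingNumber := by
    rw [mk_sum, lift_id, lift_id, mk_prod, lift_id, lift_id]
    refine add_lt_of_lt aleph0_lt_splittingNumber.le (mul_lt_of_lt aleph0_lt_splittingNumber.le
      (mk_le_aleph0.trans_lt aleph0_lt_splittingNumber) (he.card_Iio b)) ?_
    refine (mk_iUnion_le _).trans_lt (mul_lt_of_lt aleph0_lt_splittingNumber.le
      (mk_le_aleph0.trans_lt aleph0_lt_splittingNumber)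
      (lt_of_le_of_lt (ciSup_le' fun θ => hT.count b (τ (st θ))) hμ))
  have hMex : ∀ θ β, ∃ M : List ℕ → Set ℕ, (∀ t, M t ∈ genIdeal 𝒜) ∧ (β < α (st θ) →
      ∀ (t : ℕ → List ℕ) (a : ℕ → ℕ), (∀ n, (st θ).1.2 <+: t n) →
        (∀ n, t n ++ [a n] ∈ (st θ).1.1) → (∀ n, t n ++ [a n] <+: t (n + 1)) →
        {n | a n ∈ side (e β) (!(τ (st θ) β)) ∧ a n ∉ M (t n)}.Finite) := by
    intro θ β
    by_cases hβ : β < α (st θ)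
    · obtain ⟨M, hM, hM'⟩ := (hτnull (st θ) β hβ _ (st θ).2.2.1).exists_bound
      exact ⟨M, hM, fun _ => hM'⟩
    · exact ⟨fun _ => ∅, fun _ => finite_mem_genIdeal finite_empty, fun h => absurd h hβ⟩
  choose M hMI hM using hMex
  obtain ⟨move, hmove, hplay⟩ := exists_moves hJ (Z := ZZ) (fun θ i => hZ _ (hpos _ _))
    (fun θ i a => (i, a) :: θ)
    (M := fun j θ i => Sum.elim (fun c => M c.1 c.2 (node (st θ) i)) (fun A : 𝒟 => A.1) j) (by
      rintro (c | A) θ i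
      · exact finite_inter_of_mem_genIdeal (hMI _ _ _) (hZA _ (hpos _ _))
      · refine hZA _ (hpos _ _) _ ?_
        obtain ⟨θ', h⟩ := mem_iUnion.1 A.2
        exact h.1)
  let run : (ℕ → Bool) → ℕ → Θ := fun x n => Nat.rec []
    (fun n θ => (x n, move n θ (x n)) :: θ) n
  have hstep : ∀ x n, st (run x (n + 1)) =
      next (st (run x n)) (x n) (move n (run x n) (x n)) := fun x n => rfl
  have hvalid : ∀ x n, node (st (run x n)) (x n) ++ [move n (run x n) (x n)] ∈
      K (st (run x n)) (x n) := fun x n => hZK _ _ _ (hmove n _ _).1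
  obtain ⟨x, l, t, hlt, hl, hfr⟩ := exists_fresh_branch he.bounded hT.card_lt
    (fun A => L A.1) (fun A => S A.1) (α := fun x n => α (st (run x n)))
    (τ := fun x n => τ (st (run x n)))
    (fun x y n h => by
      have : run x n = run y n := by
        induction n with
        | zero => rfl
        | succ n ih =>
          have := ih fun m hm => h m (hm.trans n.lt_succ_self)
          simp only [run] at this ⊢
          rw [this, h n n.lt_succ_self]
      simp only [this])
    (fun x n => by rw [hstep]; exact hαlt _ _ _ (hvalid x n))
    (fun x n β hβ => by
      rw [hstep]; exact hτeq _ _ _ (hnextnull _ _ _ (hvalid x n) β hβ))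
    (fun x n => by rw [hstep]; exact hτeq _ _ _ (hnextα _ _ _ (hvalid x n)))
  have hfresh' : IsFreshTag 𝒜 L S l t := fun A hA => hfr ⟨A, hA⟩
  let u : ℕ → List ℕ := fun n => node (st (run x n)) (x n)
  let a : ℕ → ℕ := fun n => move n (run x n) (x n)
  have hanti : Antitone fun n => (st (run x n)).1.1 := antitone_nat_of_succ_le fun n => by
    rw [hstep]
    exact (hnextK _ _ _ (hvalid x n)).trans kernel_subset
  have huP : ∀ n, u n ++ [a n] ∈ (st (run x n)).1.1 := fun n => kernel_subset (hvalid x n)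
  have hchain : ∀ n, u n ++ [a n] <+: u (n + 1) := by
    intro n
    have h1 := hroot (st (run x (n + 1))) (x (n + 1))
    have h2 : (st (run x (n + 1))).1.2 = u n ++ [a n] := by
      rw [hstep, hnext _ _ _ (hvalid x n)]
    rwa [h2] at h1
  obtain ⟨f, hf, haf⟩ := exists_branch (T := T) (t := u) (a := a)
    (fun n => hanti (Nat.zero_le n) (huP n)) hchain
  refine ⟨f, hf, fun hI => ?_⟩
  obtain ⟨F, hF, hfin, hrange⟩ := mem_genIdeal_of_subset hI haf
  obtain ⟨c, hc⟩ := hrange.bddAbove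
  -- Either the tag of `A` is a proper initial segment of `t`, and `A` itself is an obstacle, or `A`
  -- lies almost on the side of some `e β` opposite to `t`. That side is null for some state on the
  -- run, so avoiding the obstacle `M` keeps almost all steps out of it.
  have hconstraint : ∀ A ∈ F, ∃ j : (Θ × Iio b) ⊕ 𝒟, ∀ᶠ n in atTop,
      a n ∉ Sum.elim (fun c => M c.1 c.2 (u n)) (fun A : 𝒟 => A.1) j → a n ∉ A := by
    intro A hA
    by_cases hext : L A < l ∧ ∀ β < L A, S A β = t β
    · obtain ⟨n, hn⟩ := hl (L A) hext.1
      refine ⟨Sum.inr ⟨A, mem_iUnion.2 ⟨run x n, hF hA, hn.trans (hb _), fun β hβ => ?_⟩⟩,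
        Eventually.of_forall fun n h => h⟩
      rw [hext.2 β hβ, (hlt n β (hβ.trans hn)).2]
    · obtain ⟨β, hβA, hβl, hneq⟩ := hfresh'.exists_ne (hF hA) hext
      obtain ⟨n, hn⟩ := hl β hβl
      refine ⟨Sum.inl (run x n, ⟨β, hn.trans (hb _)⟩), ?_⟩
      have hpre : ∀ k, (st (run x n)).1.2 <+: u (n + k) := fun k => by
        have h1 := (st (run x n)).2.2.2 _ (hanti (Nat.le_add_right n k)
          (st (run x (n + k))).2.2.1)
        exact h1.trans (hroot _ _)
      have h1 := hM (run x n) β hn (fun k => u (n + k)) (fun k => a (n + k)) hpre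
        (fun k => hanti (Nat.le_add_right n k) (huP _)) (fun k => hchain _)
      obtain ⟨N, hN⟩ := h1.bddAbove
      obtain ⟨N', hN'⟩ := (hT.almost_subset A (hF hA) β hβA).bddAbove
      filter_upwards [eventually_gt_atTop (n + N), eventually_gt_atTop N'] with m hm hm' hmM hmA
      obtain ⟨k, rfl⟩ : ∃ k, m = n + k := ⟨m - n, by omega⟩
      have hside : a (n + k) ∉ side (e β) (!(t β)) := by
        intro hmem
        rw [(hlt n β hn).2] at hmem
        have := hN (a := k) ⟨hmem, hmM⟩
        omega
      rw [← hneq] at hside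
      have h2 := hN' (a := a (n + k)) ⟨hmA, hside⟩
      have h3 : n + k ≤ a (n + k) := (hmove _ _ _).2
      omega
  have : Nonempty ((Θ × Iio b) ⊕ 𝒟) := ⟨Sum.inl ([], ⟨α p₀, hb []⟩)⟩
  choose! j hj using hconstraint
  have hev := (eventually_all_finite hfin).2 hj
  obtain ⟨n, hn, hnF, hcn⟩ := ((hplay x (run x) (fun n => rfl)
    (hfin.toFinset.toList.map j)).and_eventually (hev.and (eventually_gt_atTop c))).exists
  have h3 : n ≤ a n := (hmove _ _ _).2
  refine absurd (hc ⟨mem_range_self n, ?_⟩) (not_le.2 (hcn.trans_le h3))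
  rintro ⟨A, hA, hnA⟩
  exact hnF A hA (hn (j A) (List.mem_map.2 ⟨A, by simpa using hA, rfl⟩)) hnA

end PositiveBranch

/-! ### Splitting an infinite set into infinitely many pieces. -/

section Pieces

/-- Countably many pairwise disjoint infinite subsets of an infinite set. -/
noncomputable def piece (Z : Set ℕ) (j : ℕ) : Set ℕ :=
  range fun k => Nat.nth (· ∈ Z) (Nat.pair j k)

variable {Z : Set ℕ}

lemma piece_subset (hZ : Z.Infinite) (j : ℕ) : piece Z j ⊆ Z := by
  rintro _ ⟨k, rfl⟩
  exact Nat.nth_mem_of_infinite hZ _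

lemma piece_infinite (hZ : Z.Infinite) (j : ℕ) : (piece Z j).Infinite := by
  refine infinite_range_of_injective fun k k' h => ?_
  have := Nat.nth_injective hZ h
  rw [Nat.pair_eq_pair] at this
  exact this.2

lemma disjoint_piece (hZ : Z.Infinite) {i j : ℕ} (h : i ≠ j) :
    Disjoint (piece Z i) (piece Z j) := by
  refine disjoint_left.2 ?_
  rintro _ ⟨k, rfl⟩ ⟨k', hk'⟩
  have := Nat.nth_injective hZ hk'
  rw [Nat.pair_eq_pair] at this
  exact h this.1.symm

lemma piece_injective (hZ : Z.Infinite) : Function.Injective (piece Z) := by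
  intro i j h
  by_contra hne
  have := disjoint_piece hZ hne
  rw [h, disjoint_self] at this
  exact (piece_infinite hZ j).nonempty.ne_empty this

end Pieces

/-! ### The recursion of length `𝔠` and the conclusion. -/

section Construction

variable {ι : Type} [LinearOrder ι] {e : ι → Set ℕ}

/-- The family of the pieces of the sets in an indexed family of tagged sets. -/
def pieceFamily {Γ : Type} (G : Γ → Set ℕ × ι × (ι → Bool)) : Set (Set ℕ) :=
  {B | ∃ γ j, B = piece (G γ).1 j}

/-- An indexed family of tagged sets with almost disjoint pieces and distinct tags. -/
structure TaggedSets (e : ι → Set ℕ) {Γ : Type} (G : Γ → Set ℕ × ι × (ι → Bool)) : Prop where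
  infinite : ∀ γ, (G γ).1.Infinite
  almostDisjoint : ∀ γ γ', γ ≠ γ' → ∀ j j', (piece (G γ).1 j ∩ piece (G γ').1 j').Finite
  almost_subset : ∀ γ, ∀ β < (G γ).2.1, ((G γ).1 \ side (e β) ((G γ).2.2 β)).Finite
  tag_injective : ∀ γ γ', (G γ).2.1 = (G γ').2.1 →
    (∀ β < (G γ).2.1, (G γ).2.2 β = (G γ').2.2 β) → γ = γ'

variable {Γ : Type} {G : Γ → Set ℕ × ι × (ι → Bool)}

lemma TaggedSets.eq_of_piece_eq (hG : TaggedSets e G) {γ γ' : Γ} {j j' : ℕ}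
    (h : piece (G γ).1 j = piece (G γ').1 j') : γ = γ' := by
  by_contra hne
  have := hG.almostDisjoint γ γ' hne j j'
  rw [h, inter_self] at this
  exact piece_infinite (hG.infinite γ') j' this

lemma TaggedSets.isAD (hG : TaggedSets e G) : IsAD (pieceFamily G) := by
  refine ⟨?_, ?_⟩
  · rintro _ ⟨γ, j, rfl⟩
    exact piece_infinite (hG.infinite γ) j
  · rintro _ ⟨γ, j, rfl⟩ _ ⟨γ', j', rfl⟩ hne
    by_cases h : γ = γ'
    · subst h
      have hj : j ≠ j' := fun h => hne (h ▸ rfl)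
      rw [(disjoint_piece (hG.infinite γ) hj).inter_eq]
      exact finite_empty
    · exact hG.almostDisjoint γ γ' h j j'

lemma TaggedSets.exists_taggedFamily [Nonempty ι] (hG : TaggedSets e G) (hΓ : #Γ < 𝔠) :
    ∃ L S, TaggedFamily e (pieceFamily G) L S ∧
      ∀ γ j, L (piece (G γ).1 j) = (G γ).2.1 ∧ S (piece (G γ).1 j) = (G γ).2.2 := by
  classical
  have hex : ∀ B : Set ℕ, ∃ (l : ι) (s : ι → Bool) (k : ℕ), ∀ γ j, B = piece (G γ).1 j →
      l = (G γ).2.1 ∧ s = (G γ).2.2 ∧ k = j := by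
    intro B
    by_cases hB : ∃ γ j, B = piece (G γ).1 j
    · obtain ⟨γ, j, rfl⟩ := hB
      refine ⟨(G γ).2.1, (G γ).2.2, j, fun γ' j' h => ?_⟩
      obtain rfl := hG.eq_of_piece_eq h
      exact ⟨rfl, rfl, piece_injective (hG.infinite γ) h⟩
    · exact ⟨Classical.arbitrary ι, fun _ => true, 0, fun γ j h => absurd ⟨γ, j, h⟩ hB⟩
  choose L S k hLS using hex
  refine ⟨L, S, ⟨hG.isAD, ?_, ?_, ?_⟩, fun γ j => ⟨(hLS _ γ j rfl).1, (hLS _ γ j rfl).2.1⟩⟩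
  · have : pieceFamily G = range fun c : Γ × ℕ => piece (G c.1).1 c.2 := by
      ext B
      constructor
      · rintro ⟨γ, j, rfl⟩
        exact ⟨(γ, j), rfl⟩
      · rintro ⟨⟨γ, j⟩, rfl⟩
        exact ⟨γ, j, rfl⟩
    rw [this]
    refine mk_range_le.trans_lt ?_
    rw [mk_prod, lift_id, lift_id]
    exact mul_lt_of_lt aleph0_le_continuum hΓ (mk_nat.trans_lt aleph0_lt_continuum)
  · rintro _ ⟨γ, j, rfl⟩ β hβ
    obtain ⟨h1, h2, -⟩ := hLS _ γ j rfl
    rw [h1] at hβ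
    rw [h2]
    exact (hG.almost_subset γ β hβ).subset
      (sdiff_subset_sdiff_left (piece_subset (hG.infinite γ) j))
  · intro l t
    -- Tags are distinct, so an initial segment of `t` is the tag of at most one set; the length of
    -- the tag and the number of the piece determine the member.
    let φ : {A | A ∈ pieceFamily G ∧ L A < l ∧ ∀ β < L A, S A β = t β} → Iio l × ℕ :=
      fun A => (⟨L A.1, A.2.2.1⟩, k A.1)
    have hφ : Function.Injective φ := by
      rintro ⟨A, ⟨γ, j, rfl⟩, hl, ht⟩ ⟨A', ⟨γ', j', rfl⟩, hl', ht'⟩ h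
      obtain ⟨h1, h2, h3⟩ := hLS _ γ j rfl
      obtain ⟨h1', h2', h3'⟩ := hLS _ γ' j' rfl
      have hL : L (piece (G γ).1 j) = L (piece (G γ').1 j') :=
        congrArg (fun c : Iio l × ℕ => c.1.1) h
      have hk : k (piece (G γ).1 j) = k (piece (G γ').1 j') := congrArg Prod.snd h
      rw [h1, h2] at ht
      rw [h1', h2'] at ht'
      rw [h1, h1'] at hL
      rw [h3, h3'] at hk
      have hγ : γ = γ' := hG.tag_injective γ γ' hL fun β hβ => by
        rw [ht β hβ, ht' β (hL ▸ hβ)]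
      subst hγ hk
      rfl
    refine (mk_le_of_injective hφ).trans ?_
    rw [mk_prod, lift_id, lift_id, mk_nat, max_comm]
    exact mul_le_max_of_aleph0_le_right le_rfl

/-- The requirements on the next tagged set `o` in the construction, for the request `r`: a set,
or a tree. -/
structure IsStep (e : ι → Set ℕ) (G : Γ → Set ℕ × ι × (ι → Bool))
    (r : Set ℕ ⊕ Descriptive.tree ℕ) (o : Set ℕ × ι × (ι → Bool)) : Prop where
  infinite : o.1.Infinite
  almostDisjoint : ∀ γ j, (o.1 ∩ piece (G γ).1 j).Finite
  almost_subset : ∀ β < o.2.1, (o.1 \ side (e β) (o.2.2 β)).Finite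
  fresh : ∀ γ, ¬ (o.2.1 ≤ (G γ).2.1 ∧ ∀ β < o.2.1, (G γ).2.2 β = o.2.2 β)
  subset_of_positive : ∀ X, r = Sum.inl X → X ∈ positiveSets (pieceFamily G) → o.1 ⊆ X
  exists_branch : ∀ T, r = Sum.inr T → IsBranchingTree (positiveSets (pieceFamily G)) T →
    ∃ f ∈ treeBranches T, o.1 ⊆ range f

lemma TaggedSets.univ_positive (hG : TaggedSets e G) :
    Set.univ ∈ positiveSets (pieceFamily G) := by
  rcases isEmpty_or_nonempty Γ with hΓ | ⟨⟨γ⟩⟩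
  · refine positive_of_almostDisjoint infinite_univ ?_
    rintro _ ⟨γ, -⟩
    exact isEmptyElim γ
  · refine positive_of_infinite_hits hG.isAD ?_
    refine (infinite_range_of_injective (piece_injective (hG.infinite γ))).mono ?_
    rintro _ ⟨j, rfl⟩
    refine ⟨⟨γ, j, rfl⟩, ?_⟩
    rw [univ_inter]
    exact piece_infinite (hG.infinite γ) j

lemma taggedSets_of_isStep {Δ : Type} [LinearOrder Δ] {F : Δ → Set ℕ × ι × (ι → Bool)}
    {r : Δ → Set ℕ ⊕ Descriptive.tree ℕ} {s : Set Δ}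
    (h : ∀ δ ∈ s, IsStep e (fun γ : Iio δ => F γ) (r δ) (F δ)) :
    TaggedSets e fun γ : s => F γ := by
  have hAD : ∀ γ γ' : s, γ.1 < γ'.1 → ∀ j j',
      (piece (F γ').1 j' ∩ piece (F γ).1 j).Finite := fun γ γ' hlt j j' =>
    ((h γ' γ'.2).almostDisjoint ⟨γ, hlt⟩ j).subset
      (inter_subset_inter_left _ (piece_subset (h γ' γ'.2).infinite j'))
  have htag : ∀ γ γ' : s, γ.1 < γ'.1 → (F γ').2.1 = (F γ).2.1 →
      ¬ ∀ β < (F γ').2.1, (F γ).2.2 β = (F γ').2.2 β := fun γ γ' hlt heq hcon =>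
    (h γ' γ'.2).fresh ⟨γ, hlt⟩ ⟨heq.le, hcon⟩
  refine ⟨fun γ => (h γ γ.2).infinite, fun γ γ' hne j j' => ?_,
    fun γ => (h γ γ.2).almost_subset, fun γ γ' heq hagree => ?_⟩
  · rcases lt_or_gt_of_ne fun h => hne (Subtype.ext h) with hlt | hlt
    · rw [inter_comm]
      exact hAD γ γ' hlt j j'
    · exact hAD γ' γ hlt j' j
  · by_contra hne
    rcases lt_or_gt_of_ne fun h => hne (Subtype.ext h) with hlt | hlt
    · exact htag γ γ' hlt heq.symm fun β hβ => hagree β (heq ▸ hβ)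
    · exact htag γ' γ hlt heq fun β hβ => (hagree β hβ).symm

lemma TaggedSets.exists_isStep [WellFoundedLT ι] (hG : TaggedSets e G) (he : SplitSystem ι e)
    (hsa : splittingNumber ≤ almostDisjointnessNumber) (hΓ : #Γ < 𝔠)
    (r : Set ℕ ⊕ Descriptive.tree ℕ) : ∃ o, IsStep e G r o := by
  have : Nonempty ι := by
    obtain ⟨α, -⟩ := he.splits univ infinite_univ
    exact ⟨α⟩
  obtain ⟨L, S, hT, hLS⟩ := hG.exists_taggedFamily hΓ
  -- When the request is void, the positive set `univ` serves.
  obtain ⟨X, hX, hX1, hX2⟩ : ∃ X ∈ positiveSets (pieceFamily G),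
      (∀ Y, r = Sum.inl Y → Y ∈ positiveSets (pieceFamily G) → X ⊆ Y) ∧
      ∀ T, r = Sum.inr T → IsBranchingTree (positiveSets (pieceFamily G)) T →
        ∃ f ∈ treeBranches T, X ⊆ range f := by
    rcases r with Y | T
    · by_cases hY : Y ∈ positiveSets (pieceFamily G)
      · refine ⟨Y, hY, ?_, by simp⟩
        rintro Y' h -
        rw [Sum.inl.inj h]
      · refine ⟨univ, hG.univ_positive, ?_, by simp⟩
        rintro Y' h hY'
        exact absurd (Sum.inl.inj h ▸ hY') hY
    · by_cases hTb : IsBranchingTree (positiveSets (pieceFamily G)) T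
      · obtain ⟨f, hf, hfp⟩ := hT.exists_positive_branch he hsa hTb
        refine ⟨range f, hfp, by simp, ?_⟩
        rintro T' h -
        exact ⟨f, Sum.inr.inj h ▸ hf, Subset.rfl⟩
      · refine ⟨univ, hG.univ_positive, by simp, ?_⟩
        rintro T' h hT'
        exact absurd (Sum.inr.inj h ▸ hT') hTb
  obtain ⟨Z, hZX, l, t, hZ, hZA, hZs, hfresh⟩ := hT.exists_fresh_subset he hsa hX
  refine ⟨(Z, l, t), hZ, fun γ j => hZA _ ⟨γ, j, rfl⟩, hZs, fun γ => ?_,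
    fun Y h hY => hZX.trans (hX1 Y h hY), fun T h hTb => ?_⟩
  · have := hfresh (piece (G γ).1 0) ⟨γ, 0, rfl⟩
    rwa [(hLS γ 0).1, (hLS γ 0).2] at this
  · obtain ⟨f, hf, hXf⟩ := hX2 T h hTb
    exact ⟨f, hf, hZX.trans hXf⟩

/-- If `𝔰 ≤ 𝔞`, then there is a completely separable `+`-Ramsey MAD family. -/
theorem exists_isMAD_isPlusRamsey_isCompletelySeparable
    (hsa : splittingNumber ≤ almostDisjointnessNumber) :
    ∃ 𝒜 : Set (Set ℕ), IsMAD 𝒜 ∧ IsPlusRamsey 𝒜 ∧ IsCompletelySeparable 𝒜 := by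
  obtain ⟨ι, _, _, e, he⟩ := exists_splitSystem
  have hι : Nonempty ι := by
    obtain ⟨α, -⟩ := he.splits univ infinite_univ
    exact ⟨α⟩
  let Δ : Type := (𝔠 : Cardinal.{0}).ord.ToType
  have hΔ : #Δ = 𝔠 := mk_ord_toType _
  have hIio : ∀ δ : Δ, #(Iio δ) < 𝔠 := fun δ => by
    have := mk_Iio_lt δ (by rw [hΔ, Ordinal.type_toType])
    rwa [hΔ] at this
  have hΔne : Nonempty Δ := mk_ne_zero_iff.1 (by rw [hΔ]; exact continuum_ne_zero)
  obtain ⟨r, hr⟩ : ∃ r : Δ → Set ℕ ⊕ Descriptive.tree ℕ, Function.Surjective r := by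
    have hle : #(Set ℕ ⊕ Descriptive.tree ℕ) ≤ #Δ := by
      have htree : #(Descriptive.tree ℕ) ≤ 𝔠 := by
        have h1 : #(Descriptive.tree ℕ) ≤ #(Set (List ℕ)) := mk_subtype_le _
        rwa [mk_set, mk_list_eq_aleph0, two_power_aleph0] at h1
      rw [mk_sum, lift_id, lift_id, mk_set_nat, hΔ]
      exact (add_le_add_right htree _).trans continuum_add_self.le
    obtain ⟨φ⟩ := hle
    exact ⟨Function.invFun φ, Function.invFun_surjective φ.injective⟩
  have hwf : WellFounded ((· < ·) : Δ → Δ → Prop) := wellFounded_lt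
  -- The choice is made without knowing that a step exists; `hstep` verifies this afterwards by
  -- induction.
  let F : Δ → Set ℕ × ι × (ι → Bool) := hwf.fix fun δ rec =>
    Classical.epsilon (IsStep e (fun γ : Iio δ => rec γ.1 γ.2) (r δ))
  have hF : ∀ δ, F δ = Classical.epsilon (IsStep e (fun γ : Iio δ => F γ) (r δ)) :=
    fun δ => hwf.fix_eq _ δ
  have hstep : ∀ δ, IsStep e (fun γ : Iio δ => F γ) (r δ) (F δ) := by
    intro δ
    induction δ using hwf.induction with
    | _ δ ih =>
      have hG : TaggedSets e fun γ : Iio δ => F γ :=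
        taggedSets_of_isStep fun γ hγ => ih γ hγ
      rw [hF δ]
      exact Classical.epsilon_spec (hG.exists_isStep he hsa (hIio δ) (r δ))
  have hG : TaggedSets e fun γ : (univ : Set Δ) => F γ :=
    taggedSets_of_isStep fun γ _ => hstep γ
  set 𝒜 := pieceFamily fun γ : (univ : Set Δ) => F γ with h𝒜
  have hmem : ∀ δ j, piece (F δ).1 j ∈ 𝒜 := fun δ j => ⟨⟨δ, mem_univ _⟩, j, rfl⟩
  have hsub : ∀ δ : Δ, pieceFamily (fun γ : Iio δ => F γ) ⊆ 𝒜 := by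
    rintro δ _ ⟨γ, j, rfl⟩
    exact hmem γ j
  have hcs : IsCompletelySeparable 𝒜 := by
    intro X hX
    obtain ⟨δ, hδ⟩ := hr (Sum.inl X)
    exact ⟨_, hmem δ 0, (piece_subset (hstep δ).infinite 0).trans
      ((hstep δ).subset_of_positive X hδ (positiveSets_subset (hsub δ) hX))⟩
  have hpieces : ∀ δ, (range (piece (F δ).1)).Infinite := fun δ =>
    infinite_range_of_injective (piece_injective (hstep δ).infinite)
  have hrange : ∀ δ, range (piece (F δ).1) ⊆ 𝒜 := by
    rintro δ _ ⟨j, rfl⟩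
    exact hmem δ j
  refine ⟨𝒜, ⟨(hpieces (Classical.arbitrary Δ)).mono (hrange _), hG.isAD, ?_⟩, ?_, hcs⟩
  -- A set almost disjoint from `𝒜` is positive, so by complete separability it contains a member,
  -- which is absurd.
  · intro ℬ hℬ hsubℬ C hC
    by_contra hCA
    have had : ∀ A ∈ 𝒜, (C ∩ A).Finite := fun A hA =>
      hℬ.2 hC (hsubℬ hA) fun h => hCA (h ▸ hA)
    obtain ⟨A, hA, hAC⟩ := hcs C (positive_of_almostDisjoint (hℬ.1 C hC) had)
    have := had A hA
    rw [inter_eq_right.2 hAC] at this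
    exact hG.isAD.1 A hA this
  · rintro T ⟨hroot, hT⟩
    -- Positivity for `𝒜` implies positivity for the family at stage `δ`. The range of the branch
    -- found there contains all pieces added at that stage, so it stays positive.
    obtain ⟨δ, hδ⟩ := hr (Sum.inr T)
    obtain ⟨f, hf, hFf⟩ := (hstep δ).exists_branch T hδ
      ⟨hroot, fun s hs => positiveSets_subset (hsub δ) (hT s hs)⟩
    refine ⟨f, hf, positive_of_infinite_hits hG.isAD ((hpieces δ).mono ?_)⟩
    rintro _ ⟨j, rfl⟩
    refine ⟨hmem δ j, ?_⟩
    rw [inter_eq_right.2 ((piece_subset (hstep δ).infinite j).trans hFf)]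
    exact piece_infinite (hstep δ).infinite j

/-- There is a MAD family with `𝔞` members. -/
lemma exists_isMAD_card_eq : ∃ 𝒜 : Set (Set ℕ), IsMAD 𝒜 ∧ #𝒜 = almostDisjointnessNumber := by
  have hex : ∃ 𝒜, IsMAD 𝒜 := by
    have hbase : IsAD (range (piece univ)) := by
      refine ⟨?_, ?_⟩
      · rintro _ ⟨j, rfl⟩
        exact piece_infinite infinite_univ j
      · rintro _ ⟨i, rfl⟩ _ ⟨j, rfl⟩ hne
        rw [(disjoint_piece infinite_univ fun h => hne (congrArg _ h)).inter_eq]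
        exact finite_empty
    obtain ⟨𝒜, hsub, hmax⟩ := zorn_subset_nonempty {𝒜 | IsAD 𝒜} (by
      intro c hc hchain _
      refine ⟨⋃₀ c, ⟨?_, ?_⟩, fun s hs => subset_sUnion_of_mem hs⟩
      · rintro A ⟨ℬ, hℬ, hA⟩
        exact (hc hℬ).1 A hA
      · rintro A ⟨ℬ, hℬ, hA⟩ B ⟨ℬ', hℬ', hB⟩ hne
        rcases hchain.total hℬ hℬ' with h | h
        · exact (hc hℬ').2 (h hA) hB hne
        · exact (hc hℬ).2 hA (h hB) hne) _ hbase
    exact ⟨𝒜, (infinite_range_of_injective (piece_injective infinite_univ)).mono hsub, hmax⟩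
  obtain ⟨𝒜, h𝒜⟩ := hex
  exact csInf_mem (s := {κ | ∃ 𝒜 : Set (Set ℕ), IsMAD 𝒜 ∧ Cardinal.mk 𝒜 = κ}) ⟨_, 𝒜, h𝒜, rfl⟩

end Construction

theorem theorem23 :
    (∃ 𝒜 : Set (Set ℕ), IsMAD 𝒜 ∧ IsPlusRamsey 𝒜) ∧
    (splittingNumber ≤ almostDisjointnessNumber →
      ∃ 𝒜 : Set (Set ℕ), IsMAD 𝒜 ∧ IsPlusRamsey 𝒜 ∧ IsCompletelySeparable 𝒜) := by
  refine ⟨?_, exists_isMAD_isPlusRamsey_isCompletelySeparable⟩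
  rcases le_or_gt splittingNumber almostDisjointnessNumber with h | h
  · obtain ⟨𝒜, h1, h2, -⟩ := exists_isMAD_isPlusRamsey_isCompletelySeparable h
    exact ⟨𝒜, h1, h2⟩
  · obtain ⟨𝒜, h𝒜, hcard⟩ := exists_isMAD_card_eq
    exact ⟨𝒜, h𝒜, h𝒜.isPlusRamsey_of_card_lt (hcard ▸ h)⟩
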